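/- Let $B_\bullet$ be the group generated by two infinite sequences $a_1,a_2,\dots$, $\sigma_1,\sigma_2,\dots$ subject to the relations $$a_i x_{j-1}=x_j a_i,\quad \sigma_i x_j=x_j\sigma_i\qquad (i\ge 1,\ j\ge i+2,\ x=a\text{ or }\sigma),$$ $$\sigma_i\sigma_{i+1}\sigma_i=\sigma_{i+1}\sigma_i\sigma_{i+1},\quad \sigma_{i+1}\sigma_i a_{i+1}=a_i\sigma_i,\quad \sigma_i\sigma_{i+1}a_i=a_{i+1}\sigma_i\qquad(i\ge 1).$$ Let $\partial$ be the endomorphism of $B_\bullet$ with $\partial a_i=a_{i+1}$ and $\partial\sigma_i=\sigma_{i+1}$ for all $i$, and put $x[y]=x\cdot\partial y\cdot\sigma_1\cdot(\partial x)^{-1}$ for $x,y\in B_\bullet$. Let $T$ be the set of finite rooted binary trees whose leaves are labelled by elements of $B_\bullet$; write $t_1t_2$ for the tree with left subtree $t_1$ and right subtree $t_2$. For $t_1,t_2\in T$, let $t_1[t_2]$ be the tree obtained from $t_2$ by replacing each label $y$ with $x_1[x_2[\dots x_n[y]\dots]]$, where $(x_1,\dots,x_n)$ is the left-to-right enumeration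 of the labels of $t_1$. Consider the partial operators on $T$ $$A:\ t_1(t_2t_3)\mapsto (t_1t_2)t_3,\qquad S:\ t_1(t_2t_3)\mapsto t_1[t_2]\,(t_1t_3),$$ and, for every address $\alpha$ (a finite sequence of $0$'s and $1$'s, $0$ meaning left and $1$ meaning right), let $A_\alpha$ and $S_\alpha$ be the operators that apply $A$, respectively $S$, to the $\alpha$-subtree of a tree whenever this is possible. Let $\mathcal G(\mathcal A,\mathcal S^{B_\bullet})$ be the monoid of operators generated by all $A_\alpha$, $S_\alpha$ and their inverses $A_\alpha^{-1}$, $S_\alpha^{-1}$ (as sets of pairs) under reversed composition ($fg$ is $f$ followed by $g$). Two such operators $f,g$ are near-equal, written $f\approx g$, if there is at least one tree on which both are defined, and they take the same value on every such tree. Then: 1. $B_\bullet$ equipped with the bracket is a left cancellative LD-system, i.e. $x[y[z]]=x[y][x[z]]$ for all $x,y,z$, and $x[y]=x[z]$ implies $y=z$; 2. every element of $\mathcal G(\mathcal A,\mathcal S^{B_\bullet})$ is a partial injection of $T$ into itself; 3. near-equality is a congruence on $\mathcal G(\mathcal A,\mathcal S^{B_\bullet})$; 4. the quotient $G(\mathcal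 A,\mathcal S^{B_\bullet})=\mathcal G(\mathcal A,\mathcal S^{B_\bullet})/{\approx}$, the geometry group of associativity and $B_\bullet$-twisted semi-commutativity, is a group isomorphic to $B_\bullet$; more precisely, there is an isomorphism $B_\bullet\to G(\mathcal A,\mathcal S^{B_\bullet})$ that maps $a_i$ to the class of $A_{1^{i-1}}$ and $\sigma_i$ to the class of $S_{1^{i-1}}$ for every $i\ge 1$. -/

import Mathlib

/-! ### Coloured trees and partial operators on them -/

/-- `L`-coloured trees: finite rooted binary trees whose leaves carry a label in `L`. -/
inductive CTree (L : Type) : Type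
  | leaf : L → CTree L
  | node : CTree L → CTree L → CTree L

namespace CTree

variable {L : Type}

/-- The left-to-right enumeration of the labels of a tree. -/
def labels : CTree L → List L
  | leaf x => [x]
  | node t₁ t₂ => labels t₁ ++ labels t₂

/-- Apply a map to every label of a tree. -/
def map (f : L → L) : CTree L → CTree L
  | leaf x => leaf (f x)
  | node t₁ t₂ => node (map f t₁) (map f t₂)

/-- The extension to trees of a binary operation `x, y ↦ x[y]` on the labels: `t₁[t₂]` is obtained
by replacing each label `y` of `t₂` with `x₁[x₂[…xₙ[y]…]]`, where `(x₁, …, xₙ)` is the left-to-right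
enumeration of the labels of `t₁`. -/
def bracket (br : L → L → L) (t₁ t₂ : CTree L) : CTree L :=
  map (fun y => (labels t₁).foldr br y) t₂

end CTree

/-- Operators on `L`-coloured trees, seen as sets of pairs (argument, image); `f t u` means that `f`
maps `t` to `u`. Partial mappings are the single-valued ones. -/
def Op (L : Type) : Type := CTree L → CTree L → Prop

namespace Op

variable {L : Type}

/-- Operators form a monoid under reversed composition: `f * g` is `f` followed by `g`. -/
instance : Monoid (Op L) where
  mul f g := Relation.Comp f g
  one := Eq
  mul_assoc _ _ _ := Relation.comp_assoc
  one_mul _ := Relation.eq_comp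
  mul_one _ := Relation.comp_eq

/-- The inverse operator (the converse set of pairs). -/
def inverse (f : Op L) : Op L := fun t u => f u t

/-- A partial injection: a single-valued operator with single-valued inverse. -/
def IsPartialInjection (f : Op L) : Prop :=
  (∀ t u u', f t u → f t u' → u = u') ∧ (∀ t t' u, f t u → f t' u → t = t')

/-- `f` applied to the left subtree. -/
inductive OnLeft (f : Op L) : CTree L → CTree L → Prop
  | mk (t₁ t₁' t₂ : CTree L) : f t₁ t₁' → OnLeft f (.node t₁ t₂) (.node t₁' t₂)

/-- `f` applied to the right subtree. -/
inductive OnRight (f : Op L) : CTree L → CTree L → Prop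
  | mk (t₁ t₂ t₂' : CTree L) : f t₂ t₂' → OnRight f (.node t₁ t₂) (.node t₁ t₂')

/-- The `α`-shift of `f`: `f` applied to the `α`-subtree of its argument (when that subtree exists).
An address `α` is a finite sequence of 0's (`false`, to the left) and 1's (`true`, to the right),
read from the root. -/
def shift : List Bool → Op L → Op L
  | [], f => f
  | false :: α, f => OnLeft (shift α f)
  | true :: α, f => OnRight (shift α f)

/-- Underlying relation of the associativity operator: `t₁(t₂t₃) ↦ (t₁t₂)t₃`. -/
inductive Assoc : CTree L → CTree L → Prop
  | mk (t₁ t₂ t₃ : CTree L) : Assoc (.node t₁ (.node t₂ t₃)) (.node (.node t₁ t₂) t₃)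

/-- Underlying relation of the twisted semi-commutation operator: `t₁(t₂t₃) ↦ t₁[t₂](t₁t₃)`. -/
inductive SemiComm (br : L → L → L) : CTree L → CTree L → Prop
  | mk (t₁ t₂ t₃ : CTree L) :
      SemiComm br (.node t₁ (.node t₂ t₃)) (.node (CTree.bracket br t₁ t₂) (.node t₁ t₃))

/-- The operator `A_α`. -/
def A (α : List Bool) : Op L := shift α Assoc

/-- The twisted operator `S_α`. -/
def S (br : L → L → L) (α : List Bool) : Op L := shift α (SemiComm br)

/-- The geometry monoid of associativity and twisted semi-commutativity: the monoid generated by all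
operators `A_α`, `S_α` and their inverses. -/
def geometryMonoid (br : L → L → L) : Submonoid (Op L) :=
  Submonoid.closure
    {f | ∃ α : List Bool, f = A α ∨ f = (A α).inverse ∨ f = S br α ∨ f = (S br α).inverse}

theorem A_mem (br : L → L → L) (α : List Bool) : A α ∈ geometryMonoid br :=
  Submonoid.subset_closure ⟨α, Or.inl rfl⟩

theorem S_mem (br : L → L → L) (α : List Bool) : S br α ∈ geometryMonoid br :=
  Submonoid.subset_closure ⟨α, Or.inr (Or.inr (Or.inl rfl))⟩

/-- Near-equality: there is at least one tree on which both operators are defined, and they take the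
same value on every such tree. -/
def NearEq (f g : Op L) : Prop :=
  (∃ t, (∃ u, f t u) ∧ (∃ v, g t v)) ∧ ∀ t u v, f t u → g t v → u = v

/-- The congruence on the geometry monoid generated by near-equality. -/
def nearEqCon (br : L → L → L) : Con (geometryMonoid br) :=
  conGen fun f g => NearEq (f : Op L) (g : Op L)

/-- The quotient of the geometry monoid by (the congruence generated by) near-equality. -/
abbrev GeometryGroup (br : L → L → L) : Type := (nearEqCon br).Quotient

/-- The class of `A_α`. -/
def clsA (br : L → L → L) (α : List Bool) : GeometryGroup br :=
  ((⟨A α, A_mem br α⟩ : geometryMonoid br) : (nearEqCon br).Quotient)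

/-- The class of `S_α`. -/
def clsS (br : L → L → L) (α : List Bool) : GeometryGroup br :=
  ((⟨S br α, S_mem br α⟩ : geometryMonoid br) : (nearEqCon br).Quotient)

end Op

/-- A left cancellative LD-system: `x[y[z]] = x[y][x[z]]`, with injective left translations. -/
def IsLeftCancellativeLD {L : Type} (br : L → L → L) : Prop :=
  (∀ x y z, br x (br y z) = br (br x y) (br x z)) ∧ ∀ x y z, br x y = br x z → y = z

/-! ### The group `B_•` -/

/-- The generators. Indices start from 0: `a i` and `s i` stand for `a_{i+1}` and `σ_{i+1}`. -/
inductive BGen : Type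
  | a : ℕ → BGen
  | s : ℕ → BGen

/-- The generator with the index increased by one. -/
def BGen.succ : BGen → BGen
  | .a i => .a (i + 1)
  | .s i => .s (i + 1)

open FreeGroup in
/-- The defining relations `u = v` of `B_•`. In the first four, `k` stands for `j - 1` or `j` with
`j ≥ i + 2`. -/
inductive BRel : FreeGroup BGen → FreeGroup BGen → Prop
  | aa (i k : ℕ) : i + 1 ≤ k → BRel (of (.a i) * of (.a k)) (of (.a (k + 1)) * of (.a i))
  | as (i k : ℕ) : i + 1 ≤ k → BRel (of (.a i) * of (.s k)) (of (.s (k + 1)) * of (.a i))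
  | sa (i j : ℕ) : i + 2 ≤ j → BRel (of (.s i) * of (.a j)) (of (.a j) * of (.s i))
  | ss (i j : ℕ) : i + 2 ≤ j → BRel (of (.s i) * of (.s j)) (of (.s j) * of (.s i))
  | braid (i : ℕ) : BRel (of (.s i) * of (.s (i + 1)) * of (.s i))
      (of (.s (i + 1)) * of (.s i) * of (.s (i + 1)))
  | ssa (i : ℕ) : BRel (of (.s (i + 1)) * of (.s i) * of (.a (i + 1))) (of (.a i) * of (.s i))
  | ssa' (i : ℕ) : BRel (of (.s i) * of (.s (i + 1)) * of (.a i)) (of (.a (i + 1)) * of (.s i))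

/-- The relators `u v⁻¹`. -/
def bRelators : Set (FreeGroup BGen) := {r | ∃ u v, BRel u v ∧ r = u * v⁻¹}

/-- The group `B_•`. -/
abbrev BBullet : Type := PresentedGroup bRelators

namespace BBullet

/-- The generator `a_{i+1}` of `B_•`. -/
def a (i : ℕ) : BBullet := PresentedGroup.of (.a i)

/-- The generator `σ_{i+1}` of `B_•`. -/
def s (i : ℕ) : BBullet := PresentedGroup.of (.s i)

theorem mk_eq_of_bRel {u v : FreeGroup BGen} (h : BRel u v) :
    PresentedGroup.mk bRelators u = PresentedGroup.mk bRelators v := by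
  have h1 : PresentedGroup.mk bRelators (u * v⁻¹) = 1 :=
    PresentedGroup.one_of_mem ⟨u, v, h, rfl⟩
  rw [map_mul, map_inv] at h1
  exact mul_inv_eq_one.mp h1

theorem bRel_succ {u v : FreeGroup BGen} (h : BRel u v) :
    BRel (FreeGroup.map BGen.succ u) (FreeGroup.map BGen.succ v) := by
  cases h <;> simp only [map_mul, FreeGroup.map.of, BGen.succ]
  · exact .aa _ _ (by omega)
  · exact .as _ _ (by omega)
  · exact .sa _ _ (by omega)
  · exact .ss _ _ (by omega)
  · exact .braid _
  · exact .ssa _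
  · exact .ssa' _

theorem lift_succ (u : FreeGroup BGen) :
    FreeGroup.lift (fun x : BGen => (PresentedGroup.of x.succ : BBullet)) u =
      PresentedGroup.mk bRelators (FreeGroup.map BGen.succ u) := by
  have h : FreeGroup.lift (fun x : BGen => (PresentedGroup.of x.succ : BBullet)) =
      (PresentedGroup.mk bRelators).comp (FreeGroup.map BGen.succ) := by
    ext x
    simp [PresentedGroup.of]
  exact DFunLike.congr_fun h u

/-- The endomorphism `∂` of `B_•` that maps `a_i` to `a_{i+1}` and `σ_i` to `σ_{i+1}`. -/
def shift : BBullet →* BBullet :=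
  PresentedGroup.toGroup (f := fun x : BGen => (PresentedGroup.of x.succ : BBullet)) (by
    rintro r ⟨u, v, h, rfl⟩
    rw [lift_succ, map_mul, map_mul, map_inv, map_inv, mk_eq_of_bRel (bRel_succ h),
      mul_inv_cancel])

/-- The bracket `x[y] = x · ∂y · σ₁ · ∂x⁻¹` on `B_•`. -/
def bracket (x y : BBullet) : BBullet := x * shift y * s 0 * (shift x)⁻¹

end BBullet

/-! The proof builds the inverse isomorphism. Put x ∘ y = x · ∂y · `a 0`; then (x∘y)[z] = x[y[z]]
and x[y∘z] = x[y] ∘ x[z]. Let `eval` evaluate a coloured tree with ∘, and let `spineEval` be the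
product of the values of the left subtrees along the right branch, the j-th one shifted by ∂^j,
ended by the shifted label of the last leaf. Every operator of the geometry monoid multiplies
`spineEval` on the right by a constant of B_•, and for A and S at the address 1^i the constant is
exactly `a i` or `s i`. No operator is empty (`exists_of_mem`), so the constant is unique and
defines a surjective homomorphism `evalHom` to B_•. What remains is that near-equality is its kernel
(`nearEq_iff`).

If f and g agree at a common tree, cancellation gives equal constants. Conversely, f⁻¹g is nonempty,
so f and g have a common argument. Their values u, v at a common argument have equal `spineEval`,
and they are linked: an operator changes the sequence of labels only by braid crossings (x, y) ↦
(x[y], x) and their inverses. The heart of the proof is `eq_of_linked`: linked trees with equal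
`spineEval` are equal.

For that, `spineEval` factors as a product depending on the labels only, which a crossing multiplies
by `s i`, times `buildSpine` of the shape. So if a braid w links t to u, then w · `buildSpine` u =
`buildSpine` t in B_•. With w = C⁻¹P for positive braids P, C (powers of the full twist serve as
denominators), this is an equality of positive words: P · `buildSpine` u = C · `buildSpine` t. Such
equalities are read off from an action of B_•: `a i` merges two neighbouring trees of a forest, `s
i` exchanges two and records the crossing of their leaves in an arbitrary group K with braid
relations. Merging is invertible only when the trees are deep, hence the action is on germs at deep
forests. Running both words on a forest of full trees of depth D shows that t and u have the same
shape and that the 2^D-strand cablings of P and C agree in K.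

To use this for colours, the injective but not surjective crossings of colourings are extended to
permutations of a larger set (`exists_perm`), which supply K. Composing the 2^D colours of each
cable with ∘ maps the cabled action onto the original one (`exists_evaluation`), so P and C act
equally on colourings, and injectivity of C gives equal labels. Nothing about faithfulness of the
braid group inside B_• is needed.

Injectivity of ∂, hence left cancellation and the partial injection property, comes from ∂g being
conjugate to g by long braids, up to strand counts (`exists_shift_mul_line`). -/

/-- A sequence of elements of a monoid satisfying the braid relations. -/
structure IsBraidSeq {M : Type*} [Monoid M] (b : ℕ → M) : Prop where
  comm : ∀ i j, i + 2 ≤ j → b i * b j = b j * b i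
  braid : ∀ i, b i * b (i + 1) * b i = b (i + 1) * b i * b (i + 1)

/-! ### Positive braids: block crossings, full twist, fractions -/

namespace IsBraidSeq

variable {M : Type*} [Monoid M] {b : ℕ → M}

/-- The positive braid in which strand `o` crosses over the `q` next strands. -/
def line (b : ℕ → M) (o : ℕ) : ℕ → M
  | 0 => 1
  | q + 1 => line b o q * b (o + q)

/-- The positive braid in which `p` strands, starting from `o`, cross over the `q` next strands. -/
def cross (b : ℕ → M) (o : ℕ) : ℕ → ℕ → M
  | 0, _ => 1
  | p + 1, q => line b (o + p) q * cross b o p q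

theorem line_add (o q r : ℕ) : line b o (q + r) = line b o q * line b (o + q) r := by
  induction r with
  | zero => simp [line]
  | succ r ih => rw [← add_assoc, line, ih, line, mul_assoc, add_assoc]

theorem line_one (o : ℕ) : line b o 1 = b o := by simp [line]

theorem line_mem (o q : ℕ) :
    line b o q ∈ Submonoid.closure (b '' {j | o ≤ j ∧ j < o + q}) := by
  induction q with
  | zero => exact one_mem _
  | succ q ih =>
    refine mul_mem (Submonoid.closure_mono (Set.image_mono ?_) ih)
      (Submonoid.subset_closure ⟨o + q, ⟨by omega, by omega⟩, rfl⟩)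
    rintro j ⟨h1, h2⟩
    exact ⟨h1, by omega⟩

theorem cross_mem (o p q : ℕ) :
    cross b o p q ∈ Submonoid.closure (b '' {j | o ≤ j ∧ j + 1 < o + p + q}) := by
  induction p with
  | zero => exact one_mem _
  | succ p ih =>
    refine mul_mem (Submonoid.closure_mono (Set.image_mono ?_) (line_mem (o + p) q))
      (Submonoid.closure_mono (Set.image_mono ?_) ih)
    · rintro j ⟨h1, h2⟩
      exact ⟨by omega, by omega⟩
    · rintro j ⟨h1, h2⟩
      exact ⟨by omega, by omega⟩

theorem commute_of_mem_closure {s : Set M} {x y : M} (hx : x ∈ Submonoid.closure s)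
    (h : ∀ z ∈ s, Commute z y) : Commute x y := by
  induction hx using Submonoid.closure_induction with
  | mem z hz => exact h z hz
  | one => exact Commute.one_left y
  | mul u v _ _ hu hv => exact hu.mul_left hv

variable (hb : IsBraidSeq b)
include hb

theorem commute_far {i j : ℕ} (h : i + 2 ≤ j ∨ j + 2 ≤ i) : Commute (b i) (b j) := by
  rcases h with h | h
  · exact hb.comm i j h
  · exact (hb.comm j i h).symm

theorem commute_cross {o p q j : ℕ} (h : j + 2 ≤ o ∨ o + p + q ≤ j) :
    Commute (cross b o p q) (b j) := by
  refine commute_of_mem_closure (cross_mem o p q) ?_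
  rintro _ ⟨k, ⟨h1, h2⟩, rfl⟩
  exact hb.commute_far (by omega)

theorem commute_cross_cross {o p q o' p' q' : ℕ} (h : o + p + q ≤ o') :
    Commute (cross b o p q) (cross b o' p' q') := by
  refine (commute_of_mem_closure (cross_mem o' p' q') ?_).symm
  rintro _ ⟨k, ⟨h1, h2⟩, rfl⟩
  exact (hb.commute_cross (by omega)).symm

theorem commute_cross_line {o p q o' q' : ℕ} (h : o + p + q ≤ o') :
    Commute (cross b o p q) (line b o' q') := by
  refine (commute_of_mem_closure (line_mem o' q') ?_).symm
  rintro _ ⟨k, ⟨h1, h2⟩, rfl⟩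
  exact (hb.commute_cross (by omega)).symm

omit hb in
theorem cross_add_left (o p q r : ℕ) :
    cross b o (p + q) r = cross b (o + p) q r * cross b o p r := by
  induction q with
  | zero => simp [cross]
  | succ q ih => rw [← add_assoc, cross, ih, cross, mul_assoc, add_assoc]

theorem cross_add_right (o p q r : ℕ) :
    cross b o p (q + r) = cross b o p q * cross b (o + q) p r := by
  induction p with
  | zero => simp [cross]
  | succ p ih =>
    have h := (hb.commute_cross_line (o := o) (p := p) (q := q) (o' := o + p + q) (q' := r)
      le_rfl).eq
    rw [cross, cross, cross, ih, line_add, show o + q + p = o + p + q by omega]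
    simp only [mul_assoc]
    rw [← mul_assoc (line b (o + p + q) r), ← h]
    simp only [mul_assoc]

/-- A crossing of two of the strands that pass under the long strand can be slid to its other side,
where its index drops by one. The boundary case is the braid relation, all others are far
commutations. -/
theorem mul_line {o m j : ℕ} (h1 : o ≤ j) (h2 : j + 1 < o + m) :
    b (j + 1) * line b o m = line b o m * b j := by
  induction m with
  | zero => omega
  | succ m ih =>
    by_cases h : j + 1 < o + m
    · rw [line, ← mul_assoc, ih h, mul_assoc, (hb.commute_far (i := j) (j := o + m) (by omega)).eq,
        mul_assoc]
    · obtain ⟨m, rfl⟩ : ∃ n, m = n + 1 := ⟨m - 1, by omega⟩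
      obtain rfl : j = o + m := by omega
      have hc : Commute (line b o m) (b (o + m + 1)) := by
        refine commute_of_mem_closure (line_mem o m) ?_
        rintro _ ⟨k, ⟨h3, h4⟩, rfl⟩
        exact hb.commute_far (by omega)
      have h5 := hb.braid (o + m)
      rw [line, line, show o + (m + 1) = o + m + 1 by omega]
      simp only [mul_assoc] at h5 ⊢
      rw [h5, ← mul_assoc, ← hc.eq, mul_assoc]

theorem mul_cross {o p m j : ℕ} (h1 : o ≤ j) (h2 : j + 1 < o + m) :
    b (j + p) * cross b o p m = cross b o p m * b j := by
  induction p with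
  | zero => simp [cross]
  | succ p ih =>
    rw [cross, ← mul_assoc, ← add_assoc, hb.mul_line (by omega) (by omega), mul_assoc, ih,
      mul_assoc]

theorem line_mul_cross {o p m o' q : ℕ} (h1 : o ≤ o') (h2 : o' + q < o + m) :
    line b (o' + p) q * cross b o p m = cross b o p m * line b o' q := by
  induction q with
  | zero => simp [line]
  | succ q ih =>
    rw [line, line, mul_assoc, show o' + p + q = o' + q + p by omega,
      hb.mul_cross (by omega) (by omega), ← mul_assoc, ih (by omega), mul_assoc]

theorem cross_mul_cross {o p m o' q r : ℕ} (h1 : o ≤ o') (h2 : o' + q + r ≤ o + m) :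
    cross b (o' + p) q r * cross b o p m = cross b o p m * cross b o' q r := by
  induction q with
  | zero => simp [cross]
  | succ q ih =>
    rw [cross, cross, mul_assoc, ih (by omega), ← mul_assoc, show o' + p + q = o' + q + p by omega,
      hb.line_mul_cross (by omega) (by omega), mul_assoc]

/-- The braid relation for blocks of p, q, r strands: the crossing of the q and r blocks slides
under the p block. It makes the forest action respect the braid relation. -/
theorem cross_braid (o p q r : ℕ) :
    cross b o p q * cross b (o + q) p r * cross b o q r =
      cross b (o + p) q r * cross b o p r * cross b (o + r) p q := by
  rw [← hb.cross_add_right, mul_assoc (cross b (o + p) q r), ← hb.cross_add_right,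
    ← hb.cross_mul_cross le_rfl (by omega), add_comm q r]

theorem line_double (o q : ℕ) :
    line (fun i => cross b (2 * i) 2 2) o q = cross b (2 * o) 2 (2 * q) := by
  induction q with
  | zero =>
    simp [line, cross]
  | succ q ih =>
    rw [line, ih, show 2 * (q + 1) = 2 * q + 2 by omega, hb.cross_add_right, mul_add]

/-- The 2-cabling of a block crossing is the block crossing of doubled size. This allows the
2^D-cabling to be obtained by repeated doubling. -/
theorem cross_double (o p q : ℕ) :
    cross (fun i => cross b (2 * i) 2 2) o p q = cross b (2 * o) (2 * p) (2 * q) := by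
  induction p with
  | zero => simp [cross]
  | succ p ih =>
    rw [cross, ih, hb.line_double, show 2 * (p + 1) = 2 * p + 2 by omega, mul_add, cross_add_left]

theorem pow_line_one {N i k : ℕ} (h : i + k < N) :
    b (i + k) * line b 0 N ^ k = line b 0 N ^ k * b i := by
  induction k with
  | zero => simp
  | succ k ih =>
    rw [pow_succ', ← mul_assoc, ← add_assoc, hb.mul_line (by omega) (by omega), mul_assoc,
      ih (by omega), mul_assoc]

omit hb in
theorem line_eq_mul_line (o q : ℕ) : line b o (q + 1) = b o * line b (o + 1) q := by
  rw [add_comm, line_add, line_one]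

/-- Conjugation by δ = `line b 0 (N + 1)` shifts the generators by one but misses the last one; δ²
closes the cycle by sending the last generator to the first. -/
theorem mul_line_sq (N : ℕ) :
    b 0 * line b 0 (N + 1) ^ 2 = line b 0 (N + 1) ^ 2 * b N := by
  have h1 : ∀ q, q ≤ N → line b 1 q * line b 0 (N + 1) = line b 0 (N + 1) * line b 0 q := by
    intro q hq
    induction q with
    | zero => simp [line]
    | succ q ih =>
      rw [line, mul_assoc, add_comm 1 q, hb.mul_line (by omega) (by omega), ← mul_assoc,
        ih (by omega), mul_assoc, line.eq_2 b 0 q, zero_add]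
  have h2 : line b 0 (N + 1) * line b 0 (N + 1) = line b 1 N * line b 0 (N + 1) * b N := by
    rw [h1 N le_rfl, mul_assoc]
    nth_rewrite 2 [line]
    rw [zero_add]
  rw [pow_two, h2, ← mul_assoc, ← mul_assoc, ← zero_add 1, ← line_eq_mul_line, zero_add,
    h2]

/-- The full twist on the strands `0, …, N`. -/
theorem exists_twist (N : ℕ) : ∃ c ∈ Submonoid.closure (b '' {j | j < N}),
    ∀ i < N, Commute c (b i) ∧ (∃ q ∈ Submonoid.closure (b '' {j | j < N}), c = b i * q) ∧
      (∃ q ∈ Submonoid.closure (b '' {j | j < N}), c = q * b i) := by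
  have hl : ∀ k q, k + q ≤ N → line b k q ∈ Submonoid.closure (b '' {j | j < N}) := fun k q hk =>
    Submonoid.closure_mono (Set.image_mono fun j hj => by
      have := hj.2
      simp only [Set.mem_ofPred_eq]
      omega) (line_mem k q)
  have hm := hl 0 N (by omega)
  refine ⟨line b 0 N ^ (N + 1), pow_mem hm _, fun i hi => ?_⟩
  obtain ⟨n, rfl⟩ : ∃ n, N = i + 1 + n := ⟨N - 1 - i, by omega⟩
  set δ := line b 0 (i + 1 + n) with hδ
  -- Here c = δ^(N+1). Moving `b i` through it goes cyclically: down to `b 0` along δ^i, around to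
  -- the last generator along δ², back to `b i` along δ^n, and i + 2 + n = N + 1. Divisibility by `b
  -- i` on either side comes from splitting one factor δ at its first or last generator.
  have e1 : b i * δ ^ i = δ ^ i * b 0 := by
    have := hb.pow_line_one (N := i + 1 + n) (i := 0) (k := i) (by omega)
    rwa [zero_add] at this
  have e2 : b (i + n) * δ ^ n = δ ^ n * b i := hb.pow_line_one (by omega)
  have e3 : b 0 * δ ^ 2 = δ ^ 2 * b (i + n) := by
    have := hb.mul_line_sq (i + n)
    rwa [show i + n + 1 = i + 1 + n by omega] at this
  have e4 : δ = b 0 * line b 1 (i + n) := by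
    rw [hδ, show i + 1 + n = (i + n) + 1 by omega, line_eq_mul_line]
  have e5 : δ = line b 0 (i + n) * b (i + n) := by
    rw [hδ, show i + 1 + n = (i + n) + 1 by omega, line, zero_add]
  refine ⟨?_, ⟨δ ^ i * line b 1 (i + n) * δ ^ (n + 1), ?_, ?_⟩,
    ⟨δ ^ (i + 1) * line b 0 (i + n) * δ ^ n, ?_, ?_⟩⟩
  · refine Commute.symm ?_
    change b i * _ = _ * b i
    rw [show i + 1 + n + 1 = i + (2 + n) by omega, pow_add, pow_add, ← mul_assoc, e1, mul_assoc,
      ← mul_assoc (b 0), e3, mul_assoc (δ ^ 2), e2]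
    simp only [mul_assoc]
  · exact mul_mem (mul_mem (pow_mem hm _) (hl _ _ (by omega))) (pow_mem hm _)
  · rw [show i + 1 + n + 1 = i + (1 + (n + 1)) by omega, pow_add, pow_add, pow_one]
    conv_lhs => enter [2, 1]; rw [e4]
    simp only [← mul_assoc]
    rw [e1]
  · exact mul_mem (mul_mem (pow_mem hm _) (hl _ _ (by omega))) (pow_mem hm _)
  · rw [show i + 1 + n + 1 = (i + 1) + (1 + n) by omega, pow_add, pow_add _ 1 n, pow_one]
    conv_lhs => enter [2, 1]; rw [e5]
    rw [mul_assoc (line b 0 (i + n)), e2]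
    simp only [mul_assoc]

/-- Every positive braid on finitely many strands divides a power of the full twist. -/
theorem exists_pow_twist (N : ℕ) : ∃ c ∈ Submonoid.closure (b '' {j | j < N}),
    ∀ r ∈ Submonoid.closure (b '' {j | j < N}), Commute c r ∧ ∃ m,
      (∃ q ∈ Submonoid.closure (b '' {j | j < N}), c ^ m = r * q) ∧
      (∃ q ∈ Submonoid.closure (b '' {j | j < N}), c ^ m = q * r) := by
  obtain ⟨c, hc, h⟩ := hb.exists_twist N
  have hcomm : ∀ r ∈ Submonoid.closure (b '' {j | j < N}), Commute c r := fun r hr =>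
    (commute_of_mem_closure hr (by
      rintro _ ⟨i, hi, rfl⟩
      exact (h i hi).1.symm)).symm
  refine ⟨c, hc, fun r hr => ⟨hcomm r hr, ?_⟩⟩
  induction hr using Submonoid.closure_induction with
  | mem z hz =>
    obtain ⟨i, hi, rfl⟩ := hz
    exact ⟨1, by simpa using (h i hi).2.1, by simpa using (h i hi).2.2⟩
  | one => exact ⟨0, ⟨1, one_mem _, by simp⟩, ⟨1, one_mem _, by simp⟩⟩
  | mul u v hu hv ihu ihv =>
    obtain ⟨m, ⟨q, hq, e⟩, ⟨q', hq', e'⟩⟩ := ihu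
    obtain ⟨n, ⟨p, hp, f⟩, ⟨p', hp', f'⟩⟩ := ihv
    refine ⟨m + n, ⟨p * q, mul_mem hp hq, ?_⟩, ⟨p' * q', mul_mem hp' hq', ?_⟩⟩
    · rw [add_comm, pow_add, mul_assoc, ← mul_assoc v, ← f, ((hcomm q hq).pow_left n).eq,
        ← mul_assoc, ← e, ← pow_add, ← pow_add, add_comm]
    · rw [add_comm, pow_add, ← mul_assoc, mul_assoc p', ← e', ← ((hcomm p' hp').pow_left m).eq,
        mul_assoc, ← f', ← pow_add, ← pow_add, add_comm]

omit [Monoid M] hb in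
/-- In a group, every braid is a fraction of positive braids, with commuting denominator. -/
theorem exists_fraction {G : Type*} [Group G] {b : ℕ → G} (hb : IsBraidSeq b) (w : FreeGroup ℕ) :
    ∃ P C : FreeMonoid ℕ, FreeGroup.lift b w * FreeMonoid.lift b C = FreeMonoid.lift b P ∧
      FreeMonoid.lift b C * FreeGroup.lift b w = FreeMonoid.lift b P := by
  -- The denominator must serve all letters of `w` at once, so the claim is proved for every
  -- sufficiently large strand bound n and every c dominating the positive braids on it; c then
  -- commutes with the braid and exponents add under products.
  have key : ∃ N, ∀ n, N ≤ n → ∀ c ∈ Submonoid.closure (b '' {j | j < n}),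
      (∀ r ∈ Submonoid.closure (b '' {j | j < n}), Commute c r ∧ ∃ m,
        (∃ q ∈ Submonoid.closure (b '' {j | j < n}), c ^ m = r * q) ∧
        (∃ q ∈ Submonoid.closure (b '' {j | j < n}), c ^ m = q * r)) →
      ∃ m, Commute c (FreeGroup.lift b w) ∧
        FreeGroup.lift b w * c ^ m ∈ Submonoid.closure (b '' {j | j < n}) := by
    induction w using FreeGroup.induction_on with
    | C1 => exact ⟨0, fun n _ c hc h => ⟨0, by simp, by simp⟩⟩
    | of i =>
      refine ⟨i + 1, fun n hn c hc h => ⟨0, ?_⟩⟩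
      have hi : b i ∈ Submonoid.closure (b '' {j | j < n}) :=
        Submonoid.subset_closure ⟨i, hn, rfl⟩
      simpa using ⟨(h _ hi).1, hi⟩
    | inv_of i _ =>
      refine ⟨i + 1, fun n hn c hc h => ?_⟩
      have hi : b i ∈ Submonoid.closure (b '' {j | j < n}) :=
        Submonoid.subset_closure ⟨i, hn, rfl⟩
      obtain ⟨h1, m, ⟨q, hq, e⟩, -⟩ := h _ hi
      refine ⟨m, ?_, ?_⟩
      · simpa using h1.inv_right
      · simpa [e] using hq
    | mul x y hx hy =>
      obtain ⟨N, hx⟩ := hx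
      obtain ⟨N', hy⟩ := hy
      refine ⟨max N N', fun n hn c hc h => ?_⟩
      obtain ⟨m, h1, h2⟩ := hx n (by omega) c hc h
      obtain ⟨m', h1', h2'⟩ := hy n (by omega) c hc h
      refine ⟨m + m', ?_, ?_⟩
      · rw [map_mul]
        exact h1.mul_right h1'
      · rw [map_mul, mul_assoc, pow_add, ← mul_assoc _ (c ^ m), ← (h1'.pow_left m).eq, mul_assoc,
          ← mul_assoc]
        exact mul_mem h2 h2'
  obtain ⟨N, hN⟩ := key
  obtain ⟨c, hc, h⟩ := hb.exists_pow_twist N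
  obtain ⟨m, h1, h2⟩ := hN N le_rfl c hc h
  have hle : Submonoid.closure (b '' {j | j < N}) ≤ MonoidHom.mrange (FreeMonoid.lift b) := by
    rw [Submonoid.closure_le]
    rintro _ ⟨i, -, rfl⟩
    exact ⟨FreeMonoid.of i, by simp⟩
  obtain ⟨C, hC⟩ := hle (pow_mem hc m)
  obtain ⟨P, hP⟩ := hle h2
  refine ⟨P, C, ?_, ?_⟩
  · rw [hC, hP]
  · rw [hC, hP, (h1.pow_left m).eq]

end IsBraidSeq

/-! ### Extending injective braid actions to permutations -/

namespace IsBraidSeq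

theorem exists_mem_closure_lt {M : Type*} [Monoid M] {b : ℕ → M} {r : M}
    (hr : r ∈ Submonoid.closure (Set.range b)) :
    ∃ N, ∀ n, N ≤ n → r ∈ Submonoid.closure (b '' {j | j < n}) := by
  induction hr using Submonoid.closure_induction with
  | mem z hz =>
    obtain ⟨i, rfl⟩ := hz
    exact ⟨i + 1, fun n hn => Submonoid.subset_closure ⟨i, hn, rfl⟩⟩
  | one => exact ⟨0, fun n _ => one_mem _⟩
  | mul u v _ _ hu hv =>
    obtain ⟨N, hN⟩ := hu
    obtain ⟨N', hN'⟩ := hv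
    exact ⟨max N N', fun n hn => mul_mem (hN n (by omega)) (hN' n (by omega))⟩

/-- Injective maps satisfying the braid relations extend to permutations of a larger set that
satisfy the braid relations. -/
theorem exists_perm {X : Type} {g : ℕ → Function.End X} (hg : IsBraidSeq g)
    (hinj : ∀ i, Function.Injective (g i)) :
    ∃ (Y : Type) (ι : X → Y) (π : ℕ → Equiv.Perm Y), Function.Injective ι ∧ IsBraidSeq π ∧
      ∀ i x, ι (g i x) = π i (ι x) := by
  classical
  let R := Submonoid.closure (Set.range g)
  have hR : ∀ r ∈ R, Function.Injective r := by
    intro r hr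
    induction hr using Submonoid.closure_induction with
    | mem z hz =>
      obtain ⟨i, rfl⟩ := hz
      exact hinj i
    | one => exact Function.injective_id
    | mul u v _ _ hu hv => exact hu.comp hv
  have hle : ∀ n, Submonoid.closure (g '' {j | j < n}) ≤ R := fun n =>
    Submonoid.closure_mono (Set.image_subset_range _ _)
  -- A power of the full twist on enough strands commutes with r and is a multiple of s; it supplies
  -- common multiples.
  have hore : ∀ r s : R, ∃ c : R, c * r = r * c ∧ (∃ q : R, c = s * q) ∧ ∃ q : R, c = q * s := by
    intro r s
    obtain ⟨N, hN⟩ := exists_mem_closure_lt r.2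
    obtain ⟨N', hN'⟩ := exists_mem_closure_lt s.2
    obtain ⟨c, hc, h⟩ := hg.exists_pow_twist (max N N')
    obtain ⟨-, m, ⟨q, hq, e⟩, ⟨q', hq', e'⟩⟩ := h s (hN' _ (le_max_right _ _))
    have h1 := (h r (hN _ (le_max_left _ _))).1.pow_left m
    exact ⟨⟨c ^ m, pow_mem (hle _ hc) m⟩, Subtype.ext h1.eq, ⟨⟨q, hle _ hq⟩, Subtype.ext e⟩,
      ⟨⟨q', hle _ hq'⟩, Subtype.ext e'⟩⟩
  -- Right cancellation: multiply s up to a twist power, move it to the left by commutation, and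
  -- cancel it there because it is an injective map.
  have hcancel : ∀ r₁ r₂ s : R, r₁ * s = r₂ * s → r₁ = r₂ := by
    intro r₁ r₂ s h
    obtain ⟨N, hN⟩ := exists_mem_closure_lt r₁.2
    obtain ⟨N₂, hN₂⟩ := exists_mem_closure_lt r₂.2
    obtain ⟨N', hN'⟩ := exists_mem_closure_lt s.2
    obtain ⟨c, hc, hh⟩ := hg.exists_pow_twist (max N (max N₂ N'))
    obtain ⟨-, m, ⟨q, hq, e⟩, -⟩ := hh s (hN' _ (by omega))
    have h1 := (hh r₁ (hN _ (by omega))).1.pow_left m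
    have h2 := (hh r₂ (hN₂ _ (by omega))).1.pow_left m
    have h3 : (r₁ : Function.End X) * s = r₂ * s := congrArg Subtype.val h
    have h4 : c ^ m * (r₁ : Function.End X) = c ^ m * r₂ := by
      rw [h1.eq, h2.eq, e, ← mul_assoc, ← mul_assoc, h3]
    apply Subtype.ext
    funext x
    exact hR _ (pow_mem (hle _ hc) m) (congrFun h4 x)
  choose c hc1 hc2 hc3 using hore
  choose q hq using hc3
  -- With c = q s commuting with r, the Ore condition is c r = r c = (r q) s. Every element of R
  -- becomes invertible, and Y is the localization of X.
  let : OreLocalization.OreSet (⊤ : Submonoid R) :=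
    { ore_right_cancel := fun r₁ r₂ s h => ⟨1, by rw [hcancel r₁ r₂ s h]⟩
      oreNum := fun r s => r * q r s
      oreDenom := fun r s => ⟨c r s, trivial⟩
      ore_eq := fun r s => by
        change c r s * r = r * q r s * s
        rw [mul_assoc, ← hq, hc1] }
  let : MulAction R X := Submonoid.mulAction R
  let G : ℕ → R := fun i => ⟨g i, Submonoid.subset_closure ⟨i, rfl⟩⟩
  have hG : IsBraidSeq G := ⟨fun i j h => Subtype.ext (hg.comm i j h),
    fun i => Subtype.ext (hg.braid i)⟩
  let u : ℕ → (OreLocalization (⊤ : Submonoid R) R)ˣ := fun i =>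
    OreLocalization.numeratorUnit ⟨G i, trivial⟩
  have hu : ∀ i, (u i : OreLocalization (⊤ : Submonoid R) R) =
      OreLocalization.numeratorHom (G i) := fun i => rfl
  have hub : IsBraidSeq u := by
    constructor
    · intro i j h
      apply Units.ext
      simp only [Units.val_mul, hu, ← map_mul, hG.comm i j h]
    · intro i
      apply Units.ext
      simp only [Units.val_mul, hu, ← map_mul, hG.braid i]
  let ρ := MulAction.toPermHom (OreLocalization (⊤ : Submonoid R) R)ˣ
    (OreLocalization (⊤ : Submonoid R) X)
  refine ⟨OreLocalization (⊤ : Submonoid R) X, fun x => OreLocalization.oreDiv x 1,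
    fun i => ρ (u i), ?_, ⟨?_, ?_⟩, ?_⟩
  · intro x y h
    simp only [OreLocalization.oreDiv_eq_iff] at h
    obtain ⟨a, b, h1, h2⟩ := h
    have h3 : (a : R) = b := by simpa using h2
    have h4 : ((a : R) : Function.End X) y = ((b : R) : Function.End X) x := h1
    rw [← h3] at h4
    exact (hR _ (a : R).2 h4).symm
  · intro i j h
    rw [← map_mul, ← map_mul, hub.comm i j h]
  · intro i
    rw [← map_mul, ← map_mul, ← map_mul, ← map_mul, hub.braid i]
  · intro i x
    change _ = (OreLocalization.oreDiv (G i) (1 : (⊤ : Submonoid R)) •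
      OreLocalization.oreDiv x (1 : (⊤ : Submonoid R)) : OreLocalization (⊤ : Submonoid R) X)
    rw [OreLocalization.smul_div_one]
    rfl

end IsBraidSeq

/-! ### The group B_•: the shift, the bracket and the composition ∘ -/

namespace BBullet

theorem induction {p : BBullet → Prop} (one : p 1) (ha : ∀ i, p (a i)) (hs : ∀ i, p (s i))
    (inv : ∀ x, p x → p x⁻¹) (mul : ∀ x y, p x → p y → p (x * y)) (x : BBullet) : p x := by
  obtain ⟨w, rfl⟩ := PresentedGroup.mk_surjective bRelators x
  induction w using FreeGroup.induction_on with
  | C1 => exact one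
  | of i =>
    cases i with
    | a i => exact ha i
    | s i => exact hs i
  | inv_of i h => rw [map_inv]; exact inv _ h
  | mul x y hx hy => rw [map_mul]; exact mul _ _ hx hy

theorem shift_a (i : ℕ) : shift (a i) = a (i + 1) := PresentedGroup.toGroup.of _
theorem shift_s (i : ℕ) : shift (s i) = s (i + 1) := PresentedGroup.toGroup.of _

theorem a_mul_a {i k : ℕ} (h : i + 1 ≤ k) : a i * a k = a (k + 1) * a i :=
  mk_eq_of_bRel (.aa i k h)
theorem a_mul_s {i k : ℕ} (h : i + 1 ≤ k) : a i * s k = s (k + 1) * a i :=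
  mk_eq_of_bRel (.as i k h)
theorem s_mul_a {i j : ℕ} (h : i + 2 ≤ j) : s i * a j = a j * s i :=
  mk_eq_of_bRel (.sa i j h)
theorem isBraidSeq_s : IsBraidSeq s :=
  ⟨fun i j h => mk_eq_of_bRel (.ss i j h), fun i => mk_eq_of_bRel (.braid i)⟩
theorem s_mul_s_mul_a (i : ℕ) : s (i + 1) * s i * a (i + 1) = a i * s i :=
  mk_eq_of_bRel (.ssa i)
theorem s_mul_s_mul_a' (i : ℕ) : s i * s (i + 1) * a i = a (i + 1) * s i :=
  mk_eq_of_bRel (.ssa' i)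

theorem a_mul_shift (g : BBullet) : a 0 * shift g = shift (shift g) * a 0 := by
  induction g using induction with
  | one => simp
  | ha i => rw [shift_a, shift_a, a_mul_a (by omega)]
  | hs i => rw [shift_s, shift_s, a_mul_s (by omega)]
  | inv x h =>
    rw [map_inv, map_inv, mul_inv_eq_iff_eq_mul, mul_assoc, h, inv_mul_cancel_left]
  | mul x y hx hy =>
    rw [map_mul, map_mul, ← mul_assoc, hx, mul_assoc, hy, mul_assoc]

theorem s_mul_shift (g : BBullet) : s 0 * shift (shift g) = shift (shift g) * s 0 := by
  induction g using induction with
  | one => simp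
  | ha i => rw [shift_a, shift_a, s_mul_a (by omega)]
  | hs i => rw [shift_s, shift_s, isBraidSeq_s.comm _ _ (by omega)]
  | inv x h =>
    rw [map_inv, map_inv]
    exact Commute.inv_right h
  | mul x y hx hy =>
    rw [map_mul, map_mul]
    exact Commute.mul_right hx hy

/-- The exponent sum of the generators `a_i`. -/
def expA : BBullet →* Multiplicative ℤ :=
  PresentedGroup.toGroup (f := fun x : BGen => match x with
    | .a _ => Multiplicative.ofAdd (1 : ℤ)
    | .s _ => 1) (by
    rintro r ⟨u, v, h, rfl⟩
    cases h <;> simp)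

theorem expA_a (i : ℕ) : expA (a i) = Multiplicative.ofAdd 1 := PresentedGroup.toGroup.of _
theorem expA_s (i : ℕ) : expA (s i) = 1 := PresentedGroup.toGroup.of _

theorem expA_shift (g : BBullet) : expA (shift g) = expA g := by
  induction g using induction with
  | one => simp
  | ha i => rw [shift_a, expA_a, expA_a]
  | hs i => rw [shift_s, expA_s, expA_s]
  | inv x h => rw [map_inv, map_inv, map_inv, h]
  | mul x y hx hy => rw [map_mul, map_mul, map_mul, hx, hy]

open IsBraidSeq

/-- The analogue of `mul_line` for the generators `a i`; here the number of crossings under the long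
strand changes by one, which is what the exponent sum `expA` measures. -/
theorem a_mul_line {i n : ℕ} (h : i < n) : a (i + 1) * line s 0 n = line s 0 (n + 1) * a i := by
  induction n with
  | zero => omega
  | succ n ih =>
    by_cases hi : i < n
    · rw [line, ← mul_assoc, ih hi, mul_assoc, a_mul_s (by omega), ← mul_assoc, line.eq_2 s 0 (n + 1),
        zero_add, zero_add]
    · obtain rfl : i = n := by omega
      have hc : Commute (line s 0 i) (a (i + 1)) := by
        refine commute_of_mem_closure (line_mem 0 i) ?_
        rintro _ ⟨k, ⟨h3, h4⟩, rfl⟩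
        exact s_mul_a (by omega)
      rw [line, zero_add, ← mul_assoc, ← hc.eq, mul_assoc, ← s_mul_s_mul_a', line, line, zero_add,
        zero_add]
      simp only [mul_assoc]

/-- The shift is implemented by conjugations, up to the number of strands. -/
theorem exists_shift_mul_line (g : BBullet) : ∃ m k : ℕ,
    expA g = Multiplicative.ofAdd ((m : ℤ) - k) ∧
    ∀ n, shift g * line s 0 (n + k) = line s 0 (n + m) * g := by
  induction g using induction with
  | one => exact ⟨0, 0, by simp, by simp⟩
  | ha i =>
    refine ⟨i + 2, i + 1, ?_, fun n => ?_⟩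
    · rw [expA_a]
      congr 1
      push_cast
      ring
    · rw [shift_a, a_mul_line (by omega)]
      rfl
  | hs i =>
    refine ⟨i + 2, i + 2, ?_, fun n => ?_⟩
    · rw [expA_s, sub_self]
      rfl
    · rw [shift_s, isBraidSeq_s.mul_line (by omega) (by omega)]
  | inv x h =>
    obtain ⟨m, k, h1, h2⟩ := h
    refine ⟨k, m, ?_, fun n => ?_⟩
    · rw [map_inv, h1, ← ofAdd_neg, neg_sub]
    · rw [map_inv, inv_mul_eq_iff_eq_mul, ← mul_assoc, h2, mul_inv_cancel_right]
  | mul x y hx hy =>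
    obtain ⟨m, k, h1, h2⟩ := hx
    obtain ⟨m', k', h1', h2'⟩ := hy
    refine ⟨m + m', k + k', ?_, fun n => ?_⟩
    · rw [map_mul, h1, h1', ← ofAdd_add]
      congr 1
      push_cast
      ring
    · rw [map_mul, ← add_assoc, mul_assoc, h2', add_right_comm, ← mul_assoc, h2, mul_assoc,
        add_right_comm, add_assoc]

/-- If ∂g = 1 then g has exponent sum 0, so the two long braids intertwining ∂g and g have the same
length and cancel. -/
theorem shift_injective : Function.Injective shift := by
  rw [injective_iff_map_eq_one]
  intro g hg
  obtain ⟨m, k, h1, h2⟩ := exists_shift_mul_line g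
  have h3 : expA g = 1 := by rw [← expA_shift, hg, map_one]
  have h4 : (m : ℤ) - k = 0 := Multiplicative.ofAdd.injective (h1.symm.trans h3)
  obtain rfl : m = k := by omega
  have := h2 0
  rw [hg, one_mul] at this
  exact left_eq_mul.mp this

theorem bracket_injective (x : BBullet) : Function.Injective (bracket x) := by
  intro y z h
  simp only [bracket, mul_left_inj, mul_right_inj] at h
  exact shift_injective h

/-- The composition `x ∘ y = x · ∂y · a₁` on `B_•`. -/
def circ (x y : BBullet) : BBullet := x * shift y * a 0

theorem a_mul_inv_shift (g : BBullet) : a 0 * (shift g)⁻¹ = (shift (shift g))⁻¹ * a 0 := by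
  have := a_mul_shift g⁻¹
  rwa [map_inv, map_inv] at this

theorem s_mul_inv_shift (g : BBullet) : s 0 * (shift (shift g))⁻¹ = (shift (shift g))⁻¹ * s 0 := by
  have := s_mul_shift g⁻¹
  rwa [map_inv, map_inv] at this

theorem bracket_bracket (x y z : BBullet) :
    bracket x (bracket y z) = bracket (bracket x y) (bracket x z) := by
  simp only [bracket, map_mul, map_inv, mul_inv_rev, inv_inv, shift_s, zero_add]
  have hb := isBraidSeq_s.braid 0
  rw [zero_add] at hb
  have e1 : (shift (shift y))⁻¹ * s 0 = s 0 * (shift (shift y))⁻¹ := (s_mul_inv_shift y).symm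
  calc x * (shift y * shift (shift z) * s 1 * (shift (shift y))⁻¹) * s 0 * (shift x)⁻¹
      = x * shift y * shift (shift z) * s 1 * ((shift (shift y))⁻¹ * s 0) * (shift x)⁻¹ := by group
    _ = x * shift y * shift (shift z) * (s 1 * s 0) * (shift (shift y))⁻¹ * (shift x)⁻¹ := by
        rw [e1]; group
    _ = x * shift y * shift (shift z) * (s 0 * s 1 * s 0 * (s 1)⁻¹) * (shift (shift y))⁻¹ *
          (shift x)⁻¹ := by
        rw [hb]; group
    _ = x * shift y * (s 0 * shift (shift z)) * s 1 * ((shift (shift x))⁻¹ *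
          (shift (shift x) * s 0)) * (s 1)⁻¹ * (shift (shift y))⁻¹ * (shift x)⁻¹ := by
        rw [s_mul_shift]; group
    _ = _ := by
        rw [← s_mul_shift x]; group

/-- Passing under a composed strand is passing under its two components in turn. With `bracket_circ`
this makes ∘ compatible with cabling of colourings, and lets a whole tree act through its
evaluation. -/
theorem circ_bracket (x y z : BBullet) : bracket (circ x y) z = bracket x (bracket y z) := by
  simp only [bracket, circ, map_mul, map_inv, mul_inv_rev, shift_a, shift_s, zero_add]
  have e := s_mul_s_mul_a 0
  rw [zero_add] at e
  have e1 : (shift (shift y))⁻¹ * s 0 = s 0 * (shift (shift y))⁻¹ := (s_mul_inv_shift y).symm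
  calc x * shift y * a 0 * shift z * s 0 * ((a 1)⁻¹ * ((shift (shift y))⁻¹ * (shift x)⁻¹))
      = x * shift y * (a 0 * shift z) * s 0 * (a 1)⁻¹ * (shift (shift y))⁻¹ * (shift x)⁻¹ := by
        group
    _ = x * shift y * shift (shift z) * (a 0 * s 0) * (a 1)⁻¹ * (shift (shift y))⁻¹ *
          (shift x)⁻¹ := by rw [a_mul_shift]; group
    _ = x * shift y * shift (shift z) * s 1 * (s 0 * (shift (shift y))⁻¹) * (shift x)⁻¹ := by
        rw [← e]; group
    _ = _ := by rw [← e1]; group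

theorem bracket_circ (x y z : BBullet) :
    bracket x (circ y z) = circ (bracket x y) (bracket x z) := by
  simp only [bracket, circ, map_mul, map_inv, shift_a, shift_s, zero_add]
  have e := s_mul_s_mul_a' 0
  rw [zero_add] at e
  calc x * (shift y * shift (shift z) * a 1) * s 0 * (shift x)⁻¹
      = x * shift y * shift (shift z) * (a 1 * s 0) * (shift x)⁻¹ := by group
    _ = x * shift y * (shift (shift z) * s 0) * s 1 * (a 0 * (shift x)⁻¹) := by rw [← e]; group
    _ = _ := by rw [a_mul_inv_shift, ← s_mul_shift]; group

theorem exists_circ (x : BBullet) : ∃ y z, circ y z = x :=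
  ⟨x * (a 0)⁻¹, 1, by simp [circ]⟩

theorem isLeftCancellativeLD : IsLeftCancellativeLD bracket :=
  ⟨bracket_bracket, fun x _ _ h => bracket_injective x h⟩

end BBullet

/-! ### Cabling -/

namespace IsBraidSeq

theorem op {M : Type*} [Monoid M] {b : ℕ → M} (hb : IsBraidSeq b) :
    IsBraidSeq fun i => MulOpposite.op (b i) where
  comm i j h := MulOpposite.unop_injective (hb.comm i j h).symm
  braid i := MulOpposite.unop_injective (by
    simpa [mul_assoc] using hb.braid i)

theorem map_line {M N : Type*} [Monoid M] [Monoid N] (f : M →* N) (b : ℕ → M) (o q : ℕ) :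
    f (line b o q) = line (fun i => f (b i)) o q := by
  induction q with
  | zero => simp [line]
  | succ q ih => simp [line, ih]

theorem map_cross {M N : Type*} [Monoid M] [Monoid N] (f : M →* N) (b : ℕ → M) (o p q : ℕ) :
    f (cross b o p q) = cross (fun i => f (b i)) o p q := by
  induction p with
  | zero => simp [cross]
  | succ p ih => simp [cross, ih, map_line]

/-- The cabling of a braid sequence: every strand is replaced with `2 ^ D` parallel strands. -/
def cable {M : Type*} [Monoid M] (b : ℕ → M) (D i : ℕ) : M :=
  cross b (i * 2 ^ D) (2 ^ D) (2 ^ D)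

theorem cable_double {M : Type*} [Monoid M] {b : ℕ → M} (hb : IsBraidSeq b) (D : ℕ) :
    cable (fun i => cross b (2 * i) 2 2) D = cable b (D + 1) := by
  funext i
  rw [cable, hb.cross_double, cable, pow_succ, mul_comm 2, mul_comm 2, mul_assoc]

/-- Cabling can be done on words, by substituting in the free monoid a positive word for each
letter. Hence any map respecting the action of letters respects the cabled action. -/
theorem lift_cable {M : Type*} [Monoid M] (b : ℕ → M) (D : ℕ) (P : FreeMonoid ℕ) :
    FreeMonoid.lift (cable b D) P =
      FreeMonoid.lift b (FreeMonoid.lift (cable FreeMonoid.of D) P) := by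
  have : FreeMonoid.lift (cable b D) =
      (FreeMonoid.lift b).comp (FreeMonoid.lift (cable FreeMonoid.of D)) := by
    ext i
    simp [cable, map_cross]
  rw [this]
  rfl

end IsBraidSeq

/-! ### Colourings of strands by elements of B_• -/

namespace BBullet

open IsBraidSeq MulOpposite

/-- The action of a crossing on the sequences of elements of `B_•`. -/
def crossing (i : ℕ) : Function.End (ℕ → BBullet) := fun x j =>
  if j = i then bracket (x i) (x (i + 1)) else if j = i + 1 then x i else x j

theorem isBraidSeq_crossing : IsBraidSeq crossing where
  comm i j h := by
    funext x k
    change crossing i (crossing j x) k = crossing j (crossing i x) k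
    simp only [crossing]
    split_ifs <;> first | rfl | omega
  braid i := by
    funext x k
    have h1 : i + 1 + 1 ≠ i := by omega
    have h2 : i ≠ i + 1 + 1 := by omega
    change crossing i (crossing (i + 1) (crossing i x)) k =
      crossing (i + 1) (crossing i (crossing (i + 1) x)) k
    simp only [crossing]
    by_cases k1 : k = i
    · subst k1
      simpa [h1, h2] using (bracket_bracket (x k) (x (k + 1)) (x (k + 1 + 1))).symm
    by_cases k2 : k = i + 1
    · subst k2
      simp [h1, h2]
    by_cases k3 : k = i + 1 + 1
    · subst k3
      simp [h1, h2]
    simp [k1, k2, k3]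

/-- The overcrossing colour survives unchanged, and left translations of the bracket are injective.
Crossings need not be surjective, whence the detour through `exists_perm` and twist powers. -/
theorem crossing_injective (i : ℕ) : Function.Injective (crossing i) := by
  intro x y h
  have h0 : x i = y i := by simpa [crossing] using congrFun h (i + 1)
  funext j
  by_cases h1 : j = i
  · rw [h1, h0]
  by_cases h2 : j = i + 1
  · subst h2
    have := congrFun h i
    simp only [crossing, if_true, h0] at this
    exact bracket_injective _ this
  · simpa [crossing, h1, h2] using congrFun h j

/-- The right action of positive braids on colourings, as a braid sequence in the opposite monoid. -/
def color (i : ℕ) : (Function.End (ℕ → BBullet))ᵐᵒᵖ := op (crossing i)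

theorem isBraidSeq_color : IsBraidSeq color := isBraidSeq_crossing.op

theorem color_injective {r : (Function.End (ℕ → BBullet))ᵐᵒᵖ}
    (hr : r ∈ Submonoid.closure (Set.range color)) : Function.Injective r.unop := by
  induction hr using Submonoid.closure_induction with
  | mem z hz =>
    obtain ⟨i, rfl⟩ := hz
    exact crossing_injective i
  | one => exact Function.injective_id
  | mul u v _ _ hu hv => exact hv.comp hu

/-- The map `y ↦ x_o[x_{o+1}[…[y]…]]`, with `p` brackets. -/
def act (x : ℕ → BBullet) (o : ℕ) : ℕ → BBullet → BBullet
  | 0, y => y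
  | p + 1, y => act x o p (bracket (x (o + p)) y)

theorem act_congr {x x' : ℕ → BBullet} {o p : ℕ} (h : ∀ j, o ≤ j → j < o + p → x j = x' j)
    (y : BBullet) : act x o p y = act x' o p y := by
  induction p generalizing y with
  | zero => rfl
  | succ p ih =>
    rw [act, act, h (o + p) (by omega) (by omega), ih fun j h1 h2 => h j h1 (by omega)]

theorem act_add (x : ℕ → BBullet) (o p q : ℕ) (y : BBullet) :
    act x o (p + q) y = act x o p (act x (o + p) q y) := by
  induction q generalizing y with
  | zero => rfl
  | succ q ih => rw [← add_assoc, act, ih, act, add_assoc]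

theorem line_color (o q : ℕ) (x : ℕ → BBullet) (j : ℕ) :
    (line color o q).unop x j = if j < o then x j else if j < o + q then bracket (x o) (x (j + 1))
      else if j = o + q then x o else x j := by
  induction q generalizing j with
  | zero =>
    change x j = _
    split_ifs with h1 h2 h3
    · rfl
    · omega
    · rw [h3, add_zero]
    · rfl
  | succ q ih =>
    change crossing (o + q) ((line color o q).unop x) j = _
    simp only [crossing, ih]
    split_ifs <;> first | rfl | omega | skip
    · subst j; rfl

theorem cross_color (o p q : ℕ) (x : ℕ → BBullet) (j : ℕ) :
    (cross color o p q).unop x j = if j < o then x j else if j < o + q then act x o p (x (j + p))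
      else if j < o + q + p then x (j - q) else x j := by
  induction p generalizing x j with
  | zero =>
    change x j = _
    split_ifs <;> first | rfl | omega
  | succ p ih =>
    change (cross color o p q).unop ((line color (o + p) q).unop x) j = _
    have hact : ∀ y, act ((line color (o + p) q).unop x) o p y = act x o p y := fun y =>
      act_congr (fun k h1 h2 => by rw [line_color, if_pos (by omega)]) y
    rw [ih, hact]
    simp only [line_color]
    by_cases h1 : j < o
    · rw [if_pos h1, if_pos h1, if_pos (by omega)]
    rw [if_neg h1, if_neg h1]
    by_cases h2 : j < o + q
    · rw [if_pos h2, if_pos h2, if_neg (by omega), if_pos (by omega), act, add_assoc]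
    rw [if_neg h2, if_neg h2]
    by_cases h3 : j < o + q + p
    · rw [if_pos h3, if_pos (by omega), if_pos (by omega)]
    rw [if_neg h3, if_neg (by omega), if_neg (by omega)]
    by_cases h4 : j = o + p + q
    · subst h4
      rw [if_pos rfl, if_pos (by omega)]
      congr 1
      omega
    · rw [if_neg h4, if_neg (by omega)]

/-- Composing the colours of consecutive pairs of strands. -/
def halve (x : ℕ → BBullet) (i : ℕ) : BBullet := circ (x (2 * i)) (x (2 * i + 1))

theorem halve_surjective : Function.Surjective halve := by
  intro x
  choose y z h using fun i => exists_circ (x i)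
  refine ⟨fun j => if j % 2 = 0 then y (j / 2) else z (j / 2), funext fun i => ?_⟩
  have h1 : (2 * i + 1) / 2 = i := by omega
  simp [halve, h1, h, Nat.add_mod]

/-- The two identities relating ∘ and the bracket say that composing colours pairwise turns a
crossing of doubled strands into a single crossing. -/
theorem halve_cross (i : ℕ) (x : ℕ → BBullet) :
    halve ((cross color (2 * i) 2 2).unop x) = crossing i (halve x) := by
  funext j
  simp only [halve, cross_color, crossing]
  by_cases h1 : j = i
  · subst h1
    rw [if_neg (by omega), if_pos (by omega), if_neg (by omega), if_pos (by omega), if_pos rfl]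
    simp [act, bracket_circ, circ_bracket, mul_add, add_right_comm]
  by_cases h2 : j = i + 1
  · subst h2
    rw [if_neg (by omega), if_neg (by omega), if_pos (by omega), if_neg (by omega),
      if_neg (by omega), if_pos (by omega), if_neg h1, if_pos rfl]
    congr 2
  rw [if_neg h1, if_neg h2]
  by_cases h3 : j < i
  · rw [if_pos (by omega), if_pos (by omega)]
  · rw [if_neg (by omega), if_neg (by omega), if_neg (by omega), if_neg (by omega),
      if_neg (by omega), if_neg (by omega)]

theorem halve_lift (P : FreeMonoid ℕ) (x : ℕ → BBullet) :
    halve ((FreeMonoid.lift (fun i => cross color (2 * i) 2 2) P).unop x) =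
      (FreeMonoid.lift color P).unop (halve x) := by
  induction P using FreeMonoid.recOn generalizing x with
  | one => rfl
  | of_mul i P ih =>
    rw [map_mul, map_mul, FreeMonoid.lift_eval_of, FreeMonoid.lift_eval_of]
    change halve ((FreeMonoid.lift (fun i => cross color (2 * i) 2 2) P).unop ((cross color (2 * i) 2 2).unop x)) =
      (FreeMonoid.lift color P).unop (crossing i (halve x))
    rw [ih, halve_cross]

/-- Iterating `halve` D times composes the 2^D colours of each cable. Surjectivity is what lets an
equality of cabled actions descend to the uncabled ones. -/
theorem exists_evaluation (D : ℕ) : ∃ e : (ℕ → BBullet) → (ℕ → BBullet), Function.Surjective e ∧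
    ∀ P x, e ((FreeMonoid.lift (cable color D) P).unop x) =
      (FreeMonoid.lift color P).unop (e x) := by
  induction D with
  | zero =>
    refine ⟨id, Function.surjective_id, fun P x => ?_⟩
    have : cable color 0 = color := by
      funext i
      simp [cable, cross, line]
    rw [this]
    rfl
  | succ D ih =>
    obtain ⟨e, he, h⟩ := ih
    refine ⟨e ∘ halve, he.comp halve_surjective, fun P x => ?_⟩
    rw [← isBraidSeq_color.cable_double, lift_cable]
    change e (halve _) = _
    rw [halve_lift, ← lift_cable, h]
    rfl

end BBullet

/-! ### Sizes, depths and full trees -/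

namespace CTree

/-- The number of leaves. -/
def size {L : Type} : CTree L → ℕ
  | leaf _ => 1
  | node t₁ t₂ => size t₁ + size t₂

/-- The length of the shortest branch. -/
def minDepth {L : Type} : CTree L → ℕ
  | leaf _ => 0
  | node t₁ t₂ => min (minDepth t₁) (minDepth t₂) + 1

/-- The left subtree. -/
def left {L : Type} : CTree L → CTree L
  | leaf x => leaf x
  | node t₁ _ => t₁

/-- The right subtree. -/
def right {L : Type} : CTree L → CTree L
  | leaf x => leaf x
  | node _ t₂ => t₂

theorem size_pos {L : Type} (t : CTree L) : 0 < size t := by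
  cases t with
  | leaf x => exact Nat.one_pos
  | node t₁ t₂ =>
    have := size_pos t₁
    simp only [size]
    omega

/-- The full binary tree of depth `D`. -/
def full : ℕ → CTree Unit
  | 0 => leaf ()
  | D + 1 => node (full D) (full D)

theorem size_full (D : ℕ) : size (full D) = 2 ^ D := by
  induction D with
  | zero => rfl
  | succ D ih => rw [full, size, ih, pow_succ, mul_two]

theorem minDepth_full (D : ℕ) : minDepth (full D) = D := by
  induction D with
  | zero => rfl
  | succ D ih => rw [full, minDepth, ih, min_self]

/-- Substitution of full trees to the leaves. -/
def expand (D : ℕ) : CTree Unit → CTree Unit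
  | leaf _ => full D
  | node t₁ t₂ => node (expand D t₁) (expand D t₂)

theorem size_expand (D : ℕ) (t : CTree Unit) : size (expand D t) = size t * 2 ^ D := by
  induction t with
  | leaf x => simp [expand, size, size_full]
  | node t₁ t₂ h₁ h₂ => rw [expand, size, h₁, h₂, size, add_mul]

/-- For D > 0 an expanded leaf is itself a node, so constructors do not tell leaves from nodes; leaf
counts, all scaled by 2^D, do. -/
theorem expand_injective (D : ℕ) : Function.Injective (expand D) := by
  intro t u h
  have hs := congrArg size h
  rw [size_expand, size_expand, Nat.mul_left_inj (by positivity)] at hs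
  induction t generalizing u with
  | leaf x =>
    cases u with
    | leaf y => rfl
    | node u₁ u₂ =>
      have h1 := size_pos u₁
      have h2 := size_pos u₂
      simp only [size] at hs
      omega
  | node t₁ t₂ h₁ h₂ =>
    cases u with
    | leaf y =>
      have h1 := size_pos t₁
      have h2 := size_pos t₂
      simp only [size] at hs
      omega
    | node u₁ u₂ =>
      simp only [expand, node.injEq] at h
      have e : ∀ a b : CTree Unit, expand D a = expand D b → size a = size b := fun a b hab => by
        have := congrArg size hab
        rwa [size_expand, size_expand, Nat.mul_left_inj (by positivity)] at this
      rw [h₁ h.1 (e _ _ h.1), h₂ h.2 (e _ _ h.2)]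

end CTree

/-! ### The action of B_• on germs at deep forests -/

namespace Forest

open CTree IsBraidSeq

/-- Merge the trees in positions `i` and `i + 1`. -/
def merge (i : ℕ) (f : ℕ → CTree Unit) (j : ℕ) : CTree Unit :=
  if j < i then f j else if j = i then node (f i) (f (i + 1)) else f (j + 1)

/-- Split the tree in position `i`. -/
def split (i : ℕ) (f : ℕ → CTree Unit) (j : ℕ) : CTree Unit :=
  if j < i then f j else if j = i then left (f i) else if j = i + 1 then right (f i) else f (j - 1)

/-- Exchange the trees in positions `i` and `i + 1`. -/
def swap (i : ℕ) (f : ℕ → CTree Unit) (j : ℕ) : CTree Unit :=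
  if j = i then f (i + 1) else if j = i + 1 then f i else f j

/-- The number of leaves before position `i`. -/
def offset (f : ℕ → CTree Unit) : ℕ → ℕ
  | 0 => 0
  | i + 1 => offset f i + size (f i)

theorem offset_congr {f g : ℕ → CTree Unit} {i : ℕ} (h : ∀ j < i, f j = g j) :
    offset f i = offset g i := by
  induction i with
  | zero => rfl
  | succ i ih => rw [offset, offset, ih fun j hj => h j (by omega), h i (by omega)]

theorem offset_merge_of_le {f : ℕ → CTree Unit} {i j : ℕ} (h : j ≤ i) :
    offset (merge i f) j = offset f j :=
  offset_congr fun k hk => by rw [merge, if_pos (by omega)]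

theorem offset_merge_of_lt {f : ℕ → CTree Unit} {i j : ℕ} (h : i < j) :
    offset (merge i f) j = offset f (j + 1) := by
  induction j with
  | zero => omega
  | succ j ih =>
    by_cases hj : i < j
    · rw [offset, ih hj, merge, if_neg (by omega), if_neg (by omega)]
      rfl
    · obtain rfl : i = j := by omega
      rw [offset, offset_merge_of_le le_rfl, merge, if_neg (by omega), if_pos rfl, size, offset,
        offset, add_assoc]

theorem offset_swap_of_le {f : ℕ → CTree Unit} {i j : ℕ} (h : j ≤ i) :
    offset (swap i f) j = offset f j :=
  offset_congr fun k hk => by rw [swap, if_neg (by omega), if_neg (by omega)]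

theorem offset_swap_succ {f : ℕ → CTree Unit} {i : ℕ} :
    offset (swap i f) (i + 1) = offset f i + size (f (i + 1)) := by
  rw [offset, offset_swap_of_le le_rfl, swap, if_pos rfl]

theorem offset_swap_of_lt {f : ℕ → CTree Unit} {i j : ℕ} (h : i + 2 ≤ j) :
    offset (swap i f) j = offset f j := by
  induction j with
  | zero => omega
  | succ j ih =>
    by_cases hj : i + 2 ≤ j
    · rw [offset, ih hj, swap, if_neg (by omega), if_neg (by omega)]
      rfl
    · obtain rfl : j = i + 1 := by omega
      rw [offset, offset_swap_succ, swap, if_neg (by omega), if_pos rfl, offset, offset]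
      omega

theorem swap_swap (i : ℕ) (f : ℕ → CTree Unit) : swap i (swap i f) = f := by
  funext j
  simp only [swap]
  split_ifs <;> first | rfl | omega | simp_all

theorem split_merge (i : ℕ) (f : ℕ → CTree Unit) : split i (merge i f) = f := by
  funext j
  simp only [split, merge]
  by_cases h1 : j < i
  · simp [h1]
  by_cases h2 : j = i
  · simp [h2, left]
  by_cases h3 : j = i + 1
  · simp [h3, right]
  rw [if_neg h1, if_neg h2, if_neg h3, if_neg (by omega), if_neg (by omega)]
  congr 1
  omega

theorem merge_split {i : ℕ} {f : ℕ → CTree Unit} (h : 0 < minDepth (f i)) :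
    merge i (split i f) = f := by
  funext j
  simp only [split, merge]
  by_cases h1 : j < i
  · simp [h1]
  by_cases h2 : j = i
  · subst h2
    cases hf : f j with
    | leaf x => simp [hf, minDepth] at h
    | node t u => simp [left, right]
  rw [if_neg h1, if_neg h2, if_neg (by omega), if_neg (by omega), if_neg (by omega)]
  rfl

section Moves

variable {K : Type} [Group K] (b : ℕ → K)

/-- The action of the generators on the pairs (forest, braid). -/
def move : BGen → (ℕ → CTree Unit) × K → (ℕ → CTree Unit) × K
  | .a i, y => (merge i y.1, y.2)
  | .s i, y => (swap i y.1, y.2 * cross b (offset y.1 i) (size (y.1 i)) (size (y.1 (i + 1))))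

/-- The inverse action of the generators. -/
def unmove : BGen → (ℕ → CTree Unit) × K → (ℕ → CTree Unit) × K
  | .a i, y => (split i y.1, y.2)
  | .s i, y => (swap i y.1, y.2 * (cross b (offset y.1 i) (size (y.1 (i + 1))) (size (y.1 i)))⁻¹)

/-- The filter of the sets that contain all forests of sufficiently deep trees. -/
def deep (K : Type) : Filter ((ℕ → CTree Unit) × K) where
  sets := {s | ∃ D, ∀ y : (ℕ → CTree Unit) × K, (∀ i, D ≤ minDepth (y.1 i)) → y ∈ s}
  univ_sets := ⟨0, fun _ _ => trivial⟩
  sets_of_superset := fun ⟨D, h⟩ hst => ⟨D, fun y hy => hst (h y hy)⟩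
  inter_sets := fun ⟨D, h⟩ ⟨D', h'⟩ => ⟨max D D', fun y hy =>
    ⟨h y fun i => (le_max_left _ _).trans (hy i), h' y fun i => (le_max_right _ _).trans (hy i)⟩⟩

theorem tendsto_move (x : BGen) : Filter.Tendsto (move b x) (deep K) (deep K) := by
  rintro s ⟨D, h⟩
  refine ⟨D, fun y hy => h _ fun j => ?_⟩
  cases x with
  | a i =>
    simp only [move, merge]
    split_ifs
    · exact hy _
    · have h1 := hy i
      have h2 := hy (i + 1)
      simp only [minDepth]
      omega
    · exact hy _
  | s i =>
    simp only [move, swap]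
    split_ifs <;> exact hy _

/-- A split costs one level of depth, so it preserves deep forests only asymptotically; this is why
germs are used. -/
theorem tendsto_unmove (x : BGen) : Filter.Tendsto (unmove b x) (deep K) (deep K) := by
  rintro s ⟨D, h⟩
  refine ⟨D + 1, fun y hy => h _ fun j => ?_⟩
  cases x with
  | a i =>
    have hi := hy i
    simp only [unmove, split]
    split_ifs
    · exact (Nat.le_succ D).trans (hy _)
    · cases hf : y.1 i with
      | leaf x => simp [hf, minDepth] at hi
      | node t u =>
        simp only [hf, minDepth] at hi
        simp only [left]
        omega
    · cases hf : y.1 i with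
      | leaf x => simp [hf, minDepth] at hi
      | node t u =>
        simp only [hf, minDepth] at hi
        simp only [right]
        omega
    · exact (Nat.le_succ D).trans (hy _)
  | s i =>
    simp only [unmove, swap]
    split_ifs <;> exact (Nat.le_succ D).trans (hy _)

theorem unmove_move (x : BGen) (y : (ℕ → CTree Unit) × K) : unmove b x (move b x y) = y := by
  cases x with
  | a i => simp [move, unmove, split_merge]
  | s i =>
    simp only [move, unmove, swap_swap, offset_swap_of_le le_rfl]
    simp [swap]

theorem move_unmove {x : BGen} {y : (ℕ → CTree Unit) × K} (h : ∀ i, 1 ≤ minDepth (y.1 i)) :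
    move b x (unmove b x y) = y := by
  cases x with
  | a i => simp [move, unmove, merge_split (h i)]
  | s i =>
    simp only [move, unmove, swap_swap, offset_swap_of_le le_rfl]
    simp [swap]

/-- The action of a generator by precomposition on the germs at deep forests. -/
def germPerm (x : BGen) : Equiv.Perm (Filter.Germ (deep K) ((ℕ → CTree Unit) × K)) where
  toFun g := g.compTendsto (move b x) (tendsto_move b x)
  invFun g := g.compTendsto (unmove b x) (tendsto_unmove b x)
  left_inv g := by
    induction g using Filter.Germ.inductionOn with
    | h g =>
      -- Depth 1 excludes leaves, on which splitting returns default subtrees and merging does not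
      -- undo it.
      refine Filter.Germ.coe_eq.mpr ⟨1, fun y hy => ?_⟩
      change g (move b x (unmove b x y)) = g y
      rw [move_unmove b hy]
  right_inv g := by
    induction g using Filter.Germ.inductionOn with
    | h g =>
      refine Filter.Germ.coe_eq.mpr ⟨0, fun y _ => ?_⟩
      change g (unmove b x (move b x y)) = g y
      rw [unmove_move]

theorem germPerm_coe (x : BGen) (g : (ℕ → CTree Unit) × K → (ℕ → CTree Unit) × K) :
    germPerm b x (g : Filter.Germ (deep K) _) = ((g ∘ move b x : _ → _) : Filter.Germ (deep K) _) :=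
  rfl

/-- The successive action of the generators of a word. -/
def run (w : List BGen) (y : (ℕ → CTree Unit) × K) : (ℕ → CTree Unit) × K :=
  w.foldl (fun y x => move b x y) y

/-- Precomposition reverses the order of composition, so a product of permutations corresponds to
running the word from left to right. -/
theorem prod_germPerm (w : List BGen) (g : (ℕ → CTree Unit) × K → (ℕ → CTree Unit) × K) :
    (w.map (germPerm b)).prod (g : Filter.Germ (deep K) ((ℕ → CTree Unit) × K)) =
      ((g ∘ run b w : _ → _) : Filter.Germ (deep K) ((ℕ → CTree Unit) × K)) := by
  induction w with
  | nil => rfl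
  | cons x w ih =>
    rw [List.map_cons, List.prod_cons, Equiv.Perm.mul_apply, ih, germPerm_coe]
    rfl

theorem prod_germPerm_eq {w w' : List BGen} (h : ∀ y, run b w y = run b w' y) :
    (w.map (germPerm b)).prod = (w'.map (germPerm b)).prod := by
  ext g
  induction g using Filter.Germ.inductionOn with
  | h g => rw [prod_germPerm, prod_germPerm, funext h]

theorem merge_merge {i k : ℕ} (h : i + 1 ≤ k) (f : ℕ → CTree Unit) :
    merge k (merge i f) = merge i (merge (k + 1) f) := by
  funext j
  simp only [merge]
  split_ifs <;> first | rfl | omega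

theorem swap_merge {i k : ℕ} (h : i + 1 ≤ k) (f : ℕ → CTree Unit) :
    swap k (merge i f) = merge i (swap (k + 1) f) := by
  funext j
  simp only [merge, swap]
  split_ifs <;> first | rfl | omega

theorem merge_swap {i j : ℕ} (h : i + 2 ≤ j) (f : ℕ → CTree Unit) :
    merge j (swap i f) = swap i (merge j f) := by
  funext k
  simp only [merge, swap]
  split_ifs <;> first | rfl | omega

theorem swap_comm {i j : ℕ} (h : i + 2 ≤ j) (f : ℕ → CTree Unit) :
    swap j (swap i f) = swap i (swap j f) := by
  funext k
  simp only [swap]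
  split_ifs <;> first | rfl | omega

theorem swap_braid (i : ℕ) (f : ℕ → CTree Unit) :
    swap i (swap (i + 1) (swap i f)) = swap (i + 1) (swap i (swap (i + 1) f)) := by
  funext k
  simp only [swap]
  split_ifs <;> first | rfl | omega

theorem merge_swap_swap (i : ℕ) (f : ℕ → CTree Unit) :
    merge (i + 1) (swap i (swap (i + 1) f)) = swap i (merge i f) := by
  funext k
  simp only [merge, swap]
  split_ifs <;> first | rfl | omega

theorem merge_swap_swap' (i : ℕ) (f : ℕ → CTree Unit) :
    merge i (swap (i + 1) (swap i f)) = swap i (merge (i + 1) f) := by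
  funext k
  simp only [merge, swap]
  split_ifs <;> first | rfl | omega

variable {b}

theorem run_aa {i k : ℕ} (h : i + 1 ≤ k) (y : (ℕ → CTree Unit) × K) :
    run b [.a i, .a k] y = run b [.a (k + 1), .a i] y :=
  Prod.ext (merge_merge h y.1) rfl

theorem run_as {i k : ℕ} (h : i + 1 ≤ k) (y : (ℕ → CTree Unit) × K) :
    run b [.a i, .s k] y = run b [.s (k + 1), .a i] y := by
  refine Prod.ext (swap_merge h y.1) ?_
  simp only [run, List.foldl, move, offset_merge_of_lt (show i < k by omega)]
  simp only [merge, if_neg (show ¬k < i by omega), if_neg (show k ≠ i by omega),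
    if_neg (show ¬k + 1 < i by omega), if_neg (show k + 1 ≠ i by omega)]

theorem run_sa {i j : ℕ} (h : i + 2 ≤ j) (y : (ℕ → CTree Unit) × K) :
    run b [.s i, .a j] y = run b [.a j, .s i] y := by
  refine Prod.ext (merge_swap h y.1) ?_
  simp only [run, List.foldl, move, offset_merge_of_le (show i ≤ j by omega)]
  simp only [merge, if_pos (show i < j by omega), if_pos (show i + 1 < j by omega)]

theorem offset_add_two (f : ℕ → CTree Unit) {i j : ℕ} (h : i + 2 ≤ j) :
    offset f i + size (f i) + size (f (i + 1)) ≤ offset f j := by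
  induction j with
  | zero => omega
  | succ j ih =>
    by_cases hj : i + 2 ≤ j
    · exact (ih hj).trans (Nat.le_add_right _ _)
    · obtain rfl : j = i + 1 := by omega
      exact le_rfl

theorem run_ssa (i : ℕ) (y : (ℕ → CTree Unit) × K) :
    run b [.s (i + 1), .s i, .a (i + 1)] y = run b [.a i, .s i] y := by
  refine Prod.ext (merge_swap_swap i y.1) ?_
  simp only [run, List.foldl, move, offset_swap_of_le (show i ≤ i + 1 by omega),
    offset_merge_of_le (le_refl i)]
  simp only [swap, merge, if_true, if_neg (show i + 1 ≠ i by omega),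
    if_neg (show i ≠ i + 1 by omega), if_neg (show i ≠ i + 1 + 1 by omega),
    if_neg (show ¬ i < i by omega), if_neg (show ¬ i + 1 < i by omega), size]
  rw [cross_add_left, mul_assoc]
  rfl

variable (hb : IsBraidSeq b)
include hb

theorem run_ss {i j : ℕ} (h : i + 2 ≤ j) (y : (ℕ → CTree Unit) × K) :
    run b [.s i, .s j] y = run b [.s j, .s i] y := by
  refine Prod.ext (swap_comm h y.1) ?_
  simp only [run, List.foldl, move, offset_swap_of_lt h, offset_swap_of_le (show i ≤ j by omega)]
  simp only [swap, if_neg (show j ≠ i by omega), if_neg (show j ≠ i + 1 by omega),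
    if_neg (show j + 1 ≠ i by omega), if_neg (show j + 1 ≠ i + 1 by omega),
    if_neg (show i ≠ j by omega), if_neg (show i ≠ j + 1 by omega),
    if_neg (show i + 1 ≠ j by omega), if_neg (show i + 1 ≠ j + 1 by omega)]
  rw [mul_assoc, mul_assoc, (hb.commute_cross_cross (offset_add_two y.1 h)).eq]

theorem run_braid (i : ℕ) (y : (ℕ → CTree Unit) × K) :
    run b [.s i, .s (i + 1), .s i] y = run b [.s (i + 1), .s i, .s (i + 1)] y := by
  refine Prod.ext (swap_braid i y.1) ?_
  simp only [run, List.foldl, move, offset_swap_of_le (show i ≤ i + 1 by omega),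
    offset_swap_of_le (le_refl i), offset_swap_succ]
  simp only [swap, if_true, if_neg (show i + 1 ≠ i by omega), if_neg (show i + 1 + 1 ≠ i by omega),
    if_neg (show i + 1 + 1 ≠ i + 1 by omega), if_neg (show i ≠ i + 1 by omega),
    if_neg (show i ≠ i + 1 + 1 by omega), if_neg (show i + 1 ≠ i + 1 + 1 by omega)]
  have := hb.cross_braid (offset y.1 i) (size (y.1 i)) (size (y.1 (i + 1))) (size (y.1 (i + 1 + 1)))
  simp only [mul_assoc] at this ⊢
  rw [this]
  rfl

theorem run_ssa' (i : ℕ) (y : (ℕ → CTree Unit) × K) :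
    run b [.s i, .s (i + 1), .a i] y = run b [.a (i + 1), .s i] y := by
  refine Prod.ext (merge_swap_swap' i y.1) ?_
  simp only [run, List.foldl, move, offset_swap_succ,
    offset_merge_of_le (show i ≤ i + 1 by omega)]
  simp only [swap, merge, if_true, if_neg (show i + 1 ≠ i by omega),
    if_pos (show i < i + 1 by omega), if_neg (show i + 1 + 1 ≠ i by omega),
    if_neg (show i + 1 + 1 ≠ i + 1 by omega),
    if_neg (show ¬ i + 1 < i + 1 by omega), size]
  rw [hb.cross_add_right, mul_assoc]

/-- All defining relations hold for the moves on every forest, shallow or deep; germs are needed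
only to make merging invertible. -/
theorem exists_germHom : ∃ Φ : BBullet →* Equiv.Perm (Filter.Germ (deep K) ((ℕ → CTree Unit) × K)),
    ∀ x, Φ (PresentedGroup.of x) = germPerm b x := by
  refine ⟨PresentedGroup.toGroup (f := germPerm b) ?_, fun x => PresentedGroup.toGroup.of _⟩
  rintro r ⟨u, v, h, rfl⟩
  rw [map_mul, map_inv, mul_inv_eq_one]
  cases h with
  | aa i k h => simpa using prod_germPerm_eq b (run_aa h)
  | as i k h => simpa using prod_germPerm_eq b (run_as h)
  | sa i j h => simpa using prod_germPerm_eq b (run_sa h)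
  | ss i j h => simpa using prod_germPerm_eq b (run_ss hb h)
  | braid i => simpa [mul_assoc] using prod_germPerm_eq b (run_braid hb i)
  | ssa i => simpa [mul_assoc] using prod_germPerm_eq b (run_ssa i)
  | ssa' i => simpa [mul_assoc] using prod_germPerm_eq b (run_ssa' hb i)

/-- Positive words that are equal in `B_•` act in the same way on all forests of sufficiently deep
trees. -/
theorem exists_run_eq {w w' : List BGen}
    (h : (w.map PresentedGroup.of : List BBullet).prod = (w'.map PresentedGroup.of).prod) :
    ∃ D, ∀ y : (ℕ → CTree Unit) × K, (∀ i, D ≤ minDepth (y.1 i)) → run b w y = run b w' y := by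
  obtain ⟨Φ, hΦ⟩ := exists_germHom hb
  have key : ∀ w : List BGen, Φ (w.map PresentedGroup.of).prod = (w.map (germPerm b)).prod := by
    intro w
    rw [map_list_prod, List.map_map]
    congr 1
    exact List.map_congr_left fun x _ => hΦ x
  have h1 := congrArg Φ h
  rw [key, key] at h1
  -- At the germ of the identity, the two permutations return the germs of the two runs themselves.
  have h2 := DFunLike.congr_fun h1
    ((id : (ℕ → CTree Unit) × K → (ℕ → CTree Unit) × K) : Filter.Germ (deep K) _)
  rw [prod_germPerm, prod_germPerm, Filter.Germ.coe_eq] at h2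
  exact h2

end Moves

end Forest

/-! ### Words that build trees, and reading off shapes and cables -/

namespace BBullet

open CTree

/-- The element of `B_•` that builds the tree `t` from its leaves. -/
def build : CTree Unit → BBullet
  | .leaf _ => 1
  | .node t₁ t₂ => build t₁ * shift (build t₂) * a 0

/-- The element of `B_•` that builds all left subtrees along the right branch of `t`. -/
def buildSpine : CTree Unit → BBullet
  | .leaf _ => 1
  | .node t₁ t₂ => build t₁ * shift (buildSpine t₂)

end BBullet

namespace Forest

open CTree IsBraidSeq BBullet

/-- The forest with first tree `t`, followed by `f`. -/
def cons (t : CTree Unit) (f : ℕ → CTree Unit) : ℕ → CTree Unit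
  | 0 => t
  | j + 1 => f j

theorem cons_injective {t t' : CTree Unit} {f f' : ℕ → CTree Unit} (h : cons t f = cons t' f') :
    t = t' ∧ f = f' :=
  ⟨congrFun h 0, funext fun j => congrFun h (j + 1)⟩

theorem merge_succ_cons (i : ℕ) (t : CTree Unit) (f : ℕ → CTree Unit) :
    merge (i + 1) (cons t f) = cons t (merge i f) := by
  funext j
  cases j with
  | zero => simp [merge, cons]
  | succ j => simp [merge, cons]

theorem merge_zero_cons (t u : CTree Unit) (f : ℕ → CTree Unit) :
    merge 0 (cons t (cons u f)) = cons (node t u) f := by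
  funext j
  cases j with
  | zero => simp [merge, cons]
  | succ j => simp [merge, cons]

/-- Successive mergings. -/
def merges (w : List ℕ) (f : ℕ → CTree Unit) : ℕ → CTree Unit :=
  w.foldl (fun f i => merge i f) f

theorem merges_append (v w : List ℕ) (f : ℕ → CTree Unit) :
    merges (v ++ w) f = merges w (merges v f) := List.foldl_append

theorem merges_succ_cons (w : List ℕ) (t : CTree Unit) (f : ℕ → CTree Unit) :
    merges (w.map Nat.succ) (cons t f) = cons t (merges w f) := by
  induction w generalizing f with
  | nil => rfl
  | cons i w ih =>
    change merges (w.map Nat.succ) (merge (i + 1) (cons t f)) = _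
    rw [merge_succ_cons, ih]
    rfl

/-- A word for `build t`. -/
def buildWord : CTree Unit → List ℕ
  | .leaf _ => []
  | .node t₁ t₂ => buildWord t₁ ++ ((buildWord t₂).map Nat.succ ++ [0])

/-- A word for `buildSpine t`. -/
def buildSpineWord : CTree Unit → List ℕ
  | .leaf _ => []
  | .node t₁ t₂ => buildWord t₁ ++ (buildSpineWord t₂).map Nat.succ

theorem shift_prod (w : List ℕ) : shift (w.map BBullet.a).prod =
    ((w.map Nat.succ).map BBullet.a).prod := by
  rw [map_list_prod, List.map_map, List.map_map]
  congr 1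

theorem prod_buildWord (t : CTree Unit) : ((buildWord t).map BBullet.a).prod = build t := by
  induction t with
  | leaf x => rfl
  | node t₁ t₂ h₁ h₂ =>
    rw [buildWord, build, List.map_append, List.map_append, List.prod_append, List.prod_append,
      ← shift_prod, h₁, h₂, ← mul_assoc]
    simp

theorem prod_buildSpineWord (t : CTree Unit) :
    ((buildSpineWord t).map BBullet.a).prod = buildSpine t := by
  induction t with
  | leaf x => rfl
  | node t₁ t₂ h₁ h₂ =>
    rw [buildSpineWord, buildSpine, List.map_append, List.prod_append, ← shift_prod,
      prod_buildWord, h₂]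

/-- The forest of the left subtrees along the right branch of `t`, expanded by full trees. -/
def spine (D : ℕ) : CTree Unit → ℕ → CTree Unit
  | .leaf _ => fun _ => full D
  | .node t₁ t₂ => cons (expand D t₁) (spine D t₂)

theorem cons_full (D : ℕ) : cons (full D) (fun _ => full D) = fun _ => full D := by
  funext j
  cases j <;> rfl

theorem merges_buildWord (D : ℕ) (t : CTree Unit) :
    merges (buildWord t) (fun _ => full D) = cons (expand D t) fun _ => full D := by
  induction t with
  | leaf x => exact (cons_full D).symm
  | node t₁ t₂ h₁ h₂ =>
    rw [buildWord, merges_append, h₁, merges_append, merges_succ_cons, h₂]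
    exact merge_zero_cons _ _ _

theorem merges_buildSpineWord (D : ℕ) (t : CTree Unit) :
    merges (buildSpineWord t) (fun _ => full D) = spine D t := by
  induction t with
  | leaf x => rfl
  | node t₁ t₂ h₁ h₂ =>
    rw [buildSpineWord, merges_append, merges_buildWord, merges_succ_cons, h₂]
    rfl

/-- Equal sizes are required: a leaf and a right comb of leaves both give the constant forest of
full trees. -/
theorem spine_injective {D : ℕ} {t u : CTree Unit} (h : spine D t = spine D u)
    (hs : size t = size u) : t = u := by
  induction t generalizing u with
  | leaf x =>
    cases u with
    | leaf y => rfl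
    | node u₁ u₂ =>
      have h1 := size_pos u₁
      have h2 := size_pos u₂
      simp only [size] at hs
      omega
  | node t₁ t₂ h₁ h₂ =>
    cases u with
    | leaf y =>
      have h1 := size_pos t₁
      have h2 := size_pos t₂
      simp only [size] at hs
      omega
    | node u₁ u₂ =>
      obtain ⟨e1, e2⟩ := cons_injective h
      obtain rfl := expand_injective D e1
      rw [h₂ e2 (by simpa [size] using hs)]

variable {K : Type} [Group K] {b : ℕ → K}

theorem run_a (w : List ℕ) (f : ℕ → CTree Unit) (k : K) :
    run b (w.map BGen.a) (f, k) = (merges w f, k) := by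
  induction w generalizing f with
  | nil => rfl
  | cons i w ih => exact ih _

theorem offset_full (D i : ℕ) : offset (fun _ => full D) i = i * 2 ^ D := by
  induction i with
  | zero => simp [offset]
  | succ i ih => rw [offset, ih, size_full, add_mul, one_mul]

/-- On a constant forest exchanges are invisible, so only the braid component changes; each tree has
2^D leaves, so a crossing is recorded as a crossing of cables. -/
theorem run_s (P : List ℕ) (D : ℕ) (k : K) :
    run b (P.map BGen.s) (fun _ => full D, k) =
      (fun _ => full D, k * (P.map (cable b D)).prod) := by
  induction P generalizing k with
  | nil => simp [run]
  | cons i P ih =>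
    change run b (P.map BGen.s) (move b (.s i) (fun _ => full D, k)) = _
    have : move b (.s i) (fun _ => full D, k) = (fun _ => full D, k * cable b D i) := by
      refine Prod.ext ?_ ?_
      · funext j
        simp [move, swap]
      · simp only [move, cable, size_full, offset_full]
    rw [this, ih, List.map_cons, List.prod_cons, mul_assoc]

theorem run_append (v w : List BGen) (y : (ℕ → CTree Unit) × K) :
    run b (v ++ w) y = run b w (run b v y) := List.foldl_append

/-- Both sides are positive words, so they act equally on the constant forest of full trees of some
depth D. The forest component of the result determines the shape, the braid component is the cabled
P or C. -/
theorem eq_and_cable_eq (hb : IsBraidSeq b) {P C : FreeMonoid ℕ} {t u : CTree Unit}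
    (hs : size t = size u)
    (h : FreeMonoid.lift s P * buildSpine u = FreeMonoid.lift s C * buildSpine t) :
    t = u ∧ ∃ D, FreeMonoid.lift (cable b D) P = FreeMonoid.lift (cable b D) C := by
  have e : ∀ (P : FreeMonoid ℕ) (t : CTree Unit),
      ((P.toList.map BGen.s ++ (buildSpineWord t).map BGen.a).map
        PresentedGroup.of : List BBullet).prod = FreeMonoid.lift s P * buildSpine t := by
    intro P t
    rw [List.map_append, List.prod_append, List.map_map, List.map_map, FreeMonoid.lift_apply,
      ← prod_buildSpineWord]
    rfl
  obtain ⟨D, hD⟩ := exists_run_eq hb ((e P u).trans (h.trans (e C t).symm))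
  have h1 := hD (fun _ => full D, 1) fun i => (minDepth_full D).ge
  rw [run_append, run_append, run_s, run_s, run_a, run_a, Prod.mk.injEq, merges_buildSpineWord,
    merges_buildSpineWord, one_mul, one_mul] at h1
  exact ⟨spine_injective h1.1.symm hs, D, by
    rw [FreeMonoid.lift_apply, FreeMonoid.lift_apply, h1.2]⟩

end Forest

/-! ### Coloured trees as shapes with label sequences; evaluations -/

namespace CTree

/-- The uncoloured tree underlying a coloured tree. -/
def shape {L : Type} : CTree L → CTree Unit
  | leaf _ => leaf ()
  | node t₁ t₂ => node (shape t₁) (shape t₂)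

/-- The tree of given shape whose labels are `x o, x (o + 1), …`. -/
def fill {L : Type} : CTree Unit → ℕ → (ℕ → L) → CTree L
  | leaf _, o, x => leaf (x o)
  | node s₁ s₂, o, x => node (fill s₁ o x) (fill s₂ (o + size s₁) x)

theorem size_shape {L : Type} (t : CTree L) : size (shape t) = size t := by
  induction t with
  | leaf x => rfl
  | node t₁ t₂ h₁ h₂ => rw [shape, size, h₁, h₂, size]

theorem fill_congr {L : Type} {s : CTree Unit} {o o' : ℕ} {x x' : ℕ → L}
    (h : ∀ j < size s, x (o + j) = x' (o' + j)) : fill s o x = fill s o' x' := by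
  induction s generalizing o o' with
  | leaf _ => exact congrArg leaf (h 0 Nat.one_pos)
  | node s₁ s₂ h₁ h₂ =>
    rw [fill, fill, h₁ fun j hj => h j (by simp only [size]; omega), h₂ fun j hj => ?_]
    rw [add_assoc, add_assoc]
    exact h _ (by simp only [size]; omega)

theorem map_fill {L : Type} {s : CTree Unit} {o o' : ℕ} {x x' : ℕ → L} {f : L → L}
    (h : ∀ j < size s, f (x (o + j)) = x' (o' + j)) : map f (fill s o x) = fill s o' x' := by
  induction s generalizing o o' with
  | leaf _ => exact congrArg leaf (h 0 Nat.one_pos)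
  | node s₁ s₂ h₁ h₂ =>
    rw [fill, fill, map, h₁ fun j hj => h j (by simp only [size]; omega), h₂ fun j hj => ?_]
    rw [add_assoc, add_assoc]
    exact h _ (by simp only [size]; omega)

theorem map_unit (f : Unit → Unit) (t : CTree Unit) : map f t = t := by
  induction t with
  | leaf x => rfl
  | node t₁ t₂ h₁ h₂ => rw [map, h₁, h₂]

theorem map_injective {L : Type} {f : L → L} (hf : Function.Injective f) :
    Function.Injective (map f) := by
  intro t u h
  induction t generalizing u with
  | leaf x =>
    cases u with
    | leaf y => exact congrArg leaf (hf (leaf.inj h))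
    | node _ _ => simp [map] at h
  | node t₁ t₂ h₁ h₂ =>
    cases u with
    | leaf y => simp [map] at h
    | node u₁ u₂ =>
      simp only [map, node.injEq] at h
      rw [h₁ h.1, h₂ h.2]

theorem shape_map {L : Type} (f : L → L) (t : CTree L) : shape (map f t) = shape t := by
  induction t with
  | leaf x => rfl
  | node t₁ t₂ h₁ h₂ => rw [map, shape, h₁, h₂, shape]

/-- The labels of a tree, as a sequence that is eventually `1`. -/
def labelSeq : CTree BBullet → ℕ → BBullet
  | leaf x, j => if j = 0 then x else 1
  | node t₁ t₂, j => if j < size t₁ then labelSeq t₁ j else labelSeq t₂ (j - size t₁)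

theorem labelSeq_of_size_le {t : CTree BBullet} {j : ℕ} (h : size t ≤ j) : labelSeq t j = 1 := by
  induction t generalizing j with
  | leaf x =>
    have : j ≠ 0 := by simp only [size] at h; omega
    simp [labelSeq, this]
  | node t₁ t₂ h₁ h₂ =>
    simp only [size] at h
    rw [labelSeq, if_neg (by omega), h₂ (by omega)]

theorem fill_shape (t : CTree BBullet) {o : ℕ} {x : ℕ → BBullet}
    (h : ∀ j < size t, x (o + j) = labelSeq t j) : fill (shape t) o x = t := by
  induction t generalizing o with
  | leaf y =>
    have := h 0 Nat.one_pos
    simpa [fill, shape, labelSeq] using this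
  | node t₁ t₂ h₁ h₂ =>
    rw [shape, fill, h₁ fun j hj => ?_, h₂ fun j hj => ?_]
    · rw [size_shape, add_assoc, h _ (by simp only [size]; omega), labelSeq, if_neg (by omega),
        Nat.add_sub_cancel_left]
    · rw [h _ (by simp only [size]; omega), labelSeq, if_pos hj]

theorem fill_labelSeq (t : CTree BBullet) : fill (shape t) 0 (labelSeq t) = t :=
  fill_shape t fun j _ => by rw [zero_add]

theorem size_fill {L : Type} (s : CTree Unit) (o : ℕ) (x : ℕ → L) : size (fill s o x) = size s := by
  induction s generalizing o with
  | leaf _ => rfl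
  | node s₁ s₂ h₁ h₂ => rw [fill, size, h₁, h₂, size]

theorem labelSeq_fill {s : CTree Unit} {o : ℕ} {x : ℕ → BBullet} {j : ℕ} (h : j < size s) :
    labelSeq (fill s o x) j = x (o + j) := by
  induction s generalizing o j with
  | leaf _ =>
    obtain rfl : j = 0 := by simp only [size] at h; omega
    simp [fill, labelSeq]
  | node s₁ s₂ h₁ h₂ =>
    simp only [size] at h
    rw [fill, labelSeq, size_fill]
    split_ifs with h3
    · exact h₁ h3
    · rw [h₂ (by omega)]
      congr 1
      omega

theorem foldr_labels_fill (s : CTree Unit) (o : ℕ) (x : ℕ → BBullet) (y : BBullet) :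
    (labels (fill s o x)).foldr BBullet.bracket y = BBullet.act x o (size s) y := by
  induction s generalizing o y with
  | leaf _ => rfl
  | node s₁ s₂ h₁ h₂ => rw [fill, labels, List.foldr_append, h₁, h₂, size, BBullet.act_add]

/-- The evaluation of a coloured tree for the operation `∘`. -/
def eval : CTree BBullet → BBullet
  | leaf x => x
  | node t₁ t₂ => BBullet.circ (eval t₁) (eval t₂)

/-- The product of the shifted evaluations of the left subtrees along the right branch. -/
def spineEval : CTree BBullet → BBullet
  | leaf x => x
  | node t₁ t₂ => eval t₁ * BBullet.shift (spineEval t₂)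

theorem foldr_labels (t : CTree BBullet) (y : BBullet) :
    (labels t).foldr BBullet.bracket y = BBullet.bracket (eval t) y := by
  induction t generalizing y with
  | leaf x => rfl
  | node t₁ t₂ h₁ h₂ => rw [labels, List.foldr_append, h₁, h₂, eval, BBullet.circ_bracket]

theorem eval_bracket (t u : CTree BBullet) :
    eval (bracket BBullet.bracket t u) = BBullet.bracket (eval t) (eval u) := by
  induction u with
  | leaf x => exact foldr_labels t x
  | node u₁ u₂ h₁ h₂ =>
    rw [eval, BBullet.bracket_circ, ← h₁, ← h₂]
    rfl

end CTree

/-! ### Factoring evaluations, and rigidity of linked trees -/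

namespace BBullet

open CTree MulOpposite

/-- The product `x_o · ∂x_{o+1} · ∂²x_{o+2} ⋯` of `m` factors. -/
def comb (x : ℕ → BBullet) (o : ℕ) : ℕ → BBullet
  | 0 => 1
  | m + 1 => comb x o m * shift^[m] (x (o + m))

theorem iterate_shift_mul (m : ℕ) (g h : BBullet) :
    shift^[m] (g * h) = shift^[m] g * shift^[m] h :=
  iterate_map_mul shift m g h

theorem comb_add (x : ℕ → BBullet) (o m n : ℕ) :
    comb x o (m + n) = comb x o m * shift^[m] (comb x (o + m) n) := by
  induction n with
  | zero => simp [comb]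
  | succ n ih =>
    rw [← add_assoc, comb, ih, comb, iterate_shift_mul, mul_assoc, ← Function.iterate_add_apply,
      add_assoc]

theorem comb_congr {x x' : ℕ → BBullet} {o m : ℕ} (h : ∀ j < m, x (o + j) = x' (o + j)) :
    comb x o m = comb x' o m := by
  induction m with
  | zero => rfl
  | succ m ih => rw [comb, comb, ih fun j hj => h j (by omega), h m (by omega)]

theorem iterate_shift_s (i : ℕ) : shift^[i] (s 0) = s i := by
  induction i with
  | zero => rfl
  | succ i ih => rw [Function.iterate_succ_apply', ih, shift_s]

/-- Since x[y] · ∂x = x · ∂y · σ₁, a crossing multiplies two consecutive factors by a shifted σ₁,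
which commutes with all later factors because they are shifted at least twice further. -/
theorem comb_crossing {i N : ℕ} (h : i + 1 < N) (x : ℕ → BBullet) :
    comb (crossing i x) 0 N = comb x 0 N * s i := by
  obtain ⟨r, rfl⟩ : ∃ r, N = i + (2 + r) := ⟨N - i - 2, by omega⟩
  have h1 : comb (crossing i x) 0 i = comb x 0 i := comb_congr fun j hj => by
    rw [crossing, if_neg (by omega), if_neg (by omega)]
  have h2 : comb (crossing i x) (0 + i + 2) r = comb x (0 + i + 2) r := comb_congr fun j hj => by
    rw [crossing, if_neg (by omega), if_neg (by omega)]
  rw [comb_add, comb_add, h1, h2, comb_add x 0 i, comb_add x (0 + i) 2, mul_assoc,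
    ← iterate_shift_s, ← iterate_shift_mul, zero_add]
  congr 2
  have h3 : crossing i x i = bracket (x i) (x (i + 1)) := by simp [crossing]
  have h4 : crossing i x (i + 1) = x i := by simp [crossing]
  simp only [comb, add_zero, Function.iterate_zero, id, one_mul, Function.iterate_succ,
    Function.comp, h3, h4]
  rw [mul_assoc (_ * _) _ (s 0), ← s_mul_shift, bracket]
  group

/-- Each `a 0` in `build t` turns one ∂ into two. This moves all labels of an evaluation to the left
of the part that depends on the shape. -/
theorem build_mul_shift (t : CTree Unit) (g : BBullet) :
    build t * shift g = shift^[size t] g * build t := by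
  induction t generalizing g with
  | leaf x => simp [build, size]
  | node t₁ t₂ h₁ h₂ =>
    rw [build, mul_assoc, a_mul_shift, ← mul_assoc, mul_assoc (build t₁), ← map_mul, h₂, map_mul,
      ← mul_assoc, h₁, size, Function.iterate_add_apply]
    simp only [mul_assoc]

theorem eval_fill (s : CTree Unit) (o : ℕ) (x : ℕ → BBullet) :
    eval (fill s o x) = comb x o (size s) * build s := by
  induction s generalizing o with
  | leaf _ => simp [fill, eval, size, comb, build]
  | node s₁ s₂ h₁ h₂ =>
    rw [fill, eval, h₁, h₂, circ, map_mul, size, comb_add, build, mul_assoc (comb x o (size s₁)),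
      ← mul_assoc (build s₁), build_mul_shift]
    simp only [mul_assoc]

theorem spineEval_fill (s : CTree Unit) (o : ℕ) (x : ℕ → BBullet) :
    spineEval (fill s o x) = comb x o (size s) * buildSpine s := by
  induction s generalizing o with
  | leaf _ => simp [fill, spineEval, size, comb, buildSpine]
  | node s₁ s₂ h₁ h₂ =>
    rw [fill, spineEval, eval_fill, h₂, map_mul, size, comb_add, buildSpine,
      mul_assoc (comb x o (size s₁)), ← mul_assoc (build s₁), build_mul_shift]
    simp only [mul_assoc]

open IsBraidSeq

/-- Colourings of `N` strands that are connected by crossings. -/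
def Linked (N : ℕ) : (ℕ → BBullet) → (ℕ → BBullet) → Prop :=
  Relation.EqvGen fun x y => ∃ i, i + 1 < N ∧ y = crossing i x

theorem linked_cross {N o p q : ℕ} (h : o + p + q ≤ N) (x : ℕ → BBullet) :
    Linked N x ((cross color o p q).unop x) := by
  have : ∀ r ∈ Submonoid.closure (color '' {j | o ≤ j ∧ j + 1 < o + p + q}), ∀ x,
      Linked N x (r.unop x) := by
    intro r hr
    induction hr using Submonoid.closure_induction with
    | mem z hz =>
      obtain ⟨i, ⟨_, hi⟩, rfl⟩ := hz
      exact fun x => .rel _ _ ⟨i, by omega, rfl⟩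
    | one => exact fun x => .refl _
    | mul u v _ _ hu hv => exact fun x => .trans _ _ _ (hu x) (hv _)
  exact this _ (cross_mem o p q) x

/-- One word w records the linking both in B_• and in the permutations of Y. Crossings used
backwards are why Y must carry permutations and not only injections. -/
theorem Linked.exists_word {N : ℕ} {x y : ℕ → BBullet} (h : Linked N x y) {Y : Type}
    {ι : (ℕ → BBullet) → Y} {π : ℕ → Equiv.Perm Y} (hπ : ∀ i x, ι (crossing i x) = π i (ι x)) :
    ∃ w : FreeGroup ℕ, comb y 0 N = comb x 0 N * FreeGroup.lift s w ∧
      ι y = (FreeGroup.lift (fun i => op (π i)) w).unop (ι x) := by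
  induction h with
  | rel x y h =>
    obtain ⟨i, hi, rfl⟩ := h
    exact ⟨FreeGroup.of i, by simp [comb_crossing hi], by simp [hπ]⟩
  | refl x => exact ⟨1, by simp, by simp⟩
  | symm x y _ ih =>
    obtain ⟨w, h1, h2⟩ := ih
    exact ⟨w⁻¹, by simp [h1], by simp [h2]⟩
  | trans x y z _ _ ih ih' =>
    obtain ⟨w, h1, h2⟩ := ih
    obtain ⟨w', h1', h2'⟩ := ih'
    exact ⟨w * w', by simp [h1, h1', mul_assoc], by simp [h2, h2']⟩

/-- The shapes and the cabled braids are recovered from an equality in B_•, then colours are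
compared by evaluating the cables. -/
theorem eq_of_linked {t u : CTree BBullet} (hs : size t = size u)
    (h : Linked (size t) (labelSeq t) (labelSeq u)) (he : spineEval t = spineEval u) : t = u := by
  obtain ⟨Y, ι, π, hι, hπ, hιπ⟩ := isBraidSeq_crossing.exists_perm crossing_injective
  obtain ⟨w, hw1, hw2⟩ := h.exists_word hιπ
  have hK := hπ.op
  set b : ℕ → (Equiv.Perm Y)ᵐᵒᵖ := fun i => op (π i)
  -- Taking fractions in the product group yields the same P and C for B_• and for the permutations.
  have hb : IsBraidSeq fun i => (s i, b i) :=
    ⟨fun i j h => Prod.ext (isBraidSeq_s.comm i j h) (hK.comm i j h),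
      fun i => Prod.ext (isBraidSeq_s.braid i) (hK.braid i)⟩
  obtain ⟨P, C, h1, h2⟩ := exists_fraction hb w
  have fst_free : (MonoidHom.fst BBullet (Equiv.Perm Y)ᵐᵒᵖ).comp
      (FreeMonoid.lift fun i => (s i, b i)) = FreeMonoid.lift s := by
    ext i
    simp
  have snd_free : (MonoidHom.snd BBullet (Equiv.Perm Y)ᵐᵒᵖ).comp
      (FreeMonoid.lift fun i => (s i, b i)) = FreeMonoid.lift b := by
    ext i
    simp
  have fst_group : (MonoidHom.fst BBullet (Equiv.Perm Y)ᵐᵒᵖ).comp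
      (FreeGroup.lift fun i => (s i, b i)) = FreeGroup.lift s := by
    ext i
    simp
  have snd_group : (MonoidHom.snd BBullet (Equiv.Perm Y)ᵐᵒᵖ).comp
      (FreeGroup.lift fun i => (s i, b i)) = FreeGroup.lift b := by
    ext i
    simp
  -- The denominator is needed on the left in B_•, to multiply the equation of the spines, and on
  -- the right in the opposite group, so that C acts after w.
  have h3 : FreeMonoid.lift s C * FreeGroup.lift s w = FreeMonoid.lift s P := by
    have := congrArg (MonoidHom.fst BBullet (Equiv.Perm Y)ᵐᵒᵖ) h2
    rwa [map_mul, ← MonoidHom.comp_apply, ← MonoidHom.comp_apply, ← MonoidHom.comp_apply, fst_free,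
      fst_group] at this
  have h4 : FreeGroup.lift b w * FreeMonoid.lift b C = FreeMonoid.lift b P := by
    have := congrArg (MonoidHom.snd BBullet (Equiv.Perm Y)ᵐᵒᵖ) h1
    rwa [map_mul, ← MonoidHom.comp_apply, ← MonoidHom.comp_apply, ← MonoidHom.comp_apply, snd_free,
      snd_group] at this
  have h5 : buildSpine (shape t) = FreeGroup.lift s w * buildSpine (shape u) := by
    rw [← fill_labelSeq t, ← fill_labelSeq u, spineEval_fill, spineEval_fill, size_shape,
      size_shape, ← hs, hw1, mul_assoc, mul_right_inj] at he
    exact he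
  obtain ⟨h6, D, h7⟩ := Forest.eq_and_cable_eq hK
    (show size (shape t) = size (shape u) by rw [size_shape, size_shape, hs])
    (show FreeMonoid.lift s P * buildSpine (shape u) =
      FreeMonoid.lift s C * buildSpine (shape t) by rw [h5, ← h3, mul_assoc])
  have hact : ∀ (W : FreeMonoid ℕ) (x : ℕ → BBullet),
      ι ((FreeMonoid.lift color W).unop x) = (FreeMonoid.lift b W).unop (ι x) := by
    intro W
    induction W using FreeMonoid.recOn with
    | one => exact fun x => rfl
    | of_mul i W ih =>
      intro x
      rw [map_mul, map_mul, FreeMonoid.lift_eval_of, FreeMonoid.lift_eval_of]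
      change ι ((FreeMonoid.lift color W).unop (crossing i x)) = _
      rw [ih, hιπ]
      rfl
  -- The equality of cables in permutations of Y restricts to colourings, as these embed
  -- equivariantly.
  have h8 : ∀ z, (FreeMonoid.lift (cable color D) P).unop z =
      (FreeMonoid.lift (cable color D) C).unop z := by
    intro z
    apply hι
    rw [lift_cable color, lift_cable color, hact, hact, ← lift_cable b, ← lift_cable b, h7]
  obtain ⟨e, he1, he2⟩ := exists_evaluation D
  have h9 : ∀ x, (FreeMonoid.lift color P).unop x = (FreeMonoid.lift color C).unop x := by
    intro x
    obtain ⟨z, rfl⟩ := he1 x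
    rw [← he2, ← he2, h8]
  have h10 : (FreeMonoid.lift color P).unop (labelSeq t) =
      (FreeMonoid.lift color C).unop (labelSeq u) := by
    apply hι
    rw [hact, hact, hw2, ← h4]
    rfl
  have h11 : labelSeq t = labelSeq u := by
    refine color_injective (r := FreeMonoid.lift color C) ?_ ((h9 _).symm.trans h10)
    rw [← FreeMonoid.mrange_lift]
    exact ⟨C, rfl⟩
  rw [← fill_labelSeq t, ← fill_labelSeq u, h6, h11]

end BBullet

/-! ### Inverses and partial injectivity of operators -/

namespace Op

open CTree BBullet MulOpposite IsBraidSeq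

variable {L : Type}

theorem inverse_shift (α : List Bool) (f : Op L) : (shift α f).inverse = shift α f.inverse := by
  induction α with
  | nil => rfl
  | cons c α ih =>
    funext t u
    cases c <;> simp only [shift, ← ih] <;> apply propext <;> constructor <;> rintro ⟨_, _, _, h⟩ <;>
      exact ⟨_, _, _, h⟩

theorem inverse_mul (f g : Op L) : (f * g).inverse = g.inverse * f.inverse := by
  funext t u
  apply propext
  constructor <;> rintro ⟨v, h1, h2⟩ <;> exact ⟨v, h2, h1⟩

theorem inverse_one : (1 : Op L).inverse = 1 := by
  funext t u
  exact propext eq_comm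

theorem inverse_mem {br : L → L → L} {f : Op L} (hf : f ∈ geometryMonoid br) :
    f.inverse ∈ geometryMonoid br := by
  induction hf using Submonoid.closure_induction with
  | mem f hf =>
    obtain ⟨α, rfl | rfl | rfl | rfl⟩ := hf
    · exact Submonoid.subset_closure ⟨α, .inr (.inl rfl)⟩
    · exact Submonoid.subset_closure ⟨α, .inl rfl⟩
    · exact Submonoid.subset_closure ⟨α, .inr (.inr (.inr rfl))⟩
    · exact Submonoid.subset_closure ⟨α, .inr (.inr (.inl rfl))⟩
  | one =>
    rw [inverse_one]
    exact one_mem _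
  | mul f g _ _ hf hg =>
    rw [inverse_mul]
    exact mul_mem hg hf

/-- A property of operators that holds for the operators `A_α` and `S_α` and is inherited by
inverses and products holds on the whole geometry monoid. -/
theorem geometryMonoid_induction {br : L → L → L} {p : Op L → Prop} (hA : ∀ α, p (A α))
    (hS : ∀ α, p (S br α)) (one : p 1) (mul : ∀ f g, p f → p g → p (f * g))
    (inv : ∀ f, p f → p f.inverse) {f : Op L} (hf : f ∈ geometryMonoid br) : p f := by
  induction hf using Submonoid.closure_induction with
  | mem f hf =>
    obtain ⟨α, rfl | rfl | rfl | rfl⟩ := hf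
    · exact hA α
    · exact inv _ (hA α)
    · exact hS α
    · exact inv _ (hS α)
  | one => exact one
  | mul f g _ _ hf hg => exact mul f g hf hg

theorem IsPartialInjection.shift {f : Op L} (hf : f.IsPartialInjection) (α : List Bool) :
    (Op.shift α f).IsPartialInjection := by
  induction α with
  | nil => exact hf
  | cons c α ih =>
    cases c
    · constructor
      · rintro _ _ _ ⟨t₁, t₁', t₂, h⟩ ⟨_, t₁'', _, h'⟩
        rw [ih.1 _ _ _ h h']
      · rintro _ _ _ ⟨t₁, t₁', t₂, h⟩ ⟨t₁'', _, _, h'⟩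
        rw [ih.2 _ _ _ h h']
    · constructor
      · rintro _ _ _ ⟨t₁, t₂, t₂', h⟩ ⟨_, _, t₂'', h'⟩
        rw [ih.1 _ _ _ h h']
      · rintro _ _ _ ⟨t₁, t₂, t₂', h⟩ ⟨_, t₂'', _, h'⟩
        rw [ih.2 _ _ _ h h']

theorem isPartialInjection_assoc : IsPartialInjection (Assoc : Op L) := by
  constructor
  · rintro _ _ _ ⟨_, _, _⟩ ⟨_, _, _⟩
    rfl
  · rintro _ _ _ ⟨_, _, _⟩ ⟨_, _, _⟩
    rfl

theorem isPartialInjection_semiComm {br : L → L → L} (h : ∀ x, Function.Injective (br x)) :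
    IsPartialInjection (SemiComm br) := by
  constructor
  · rintro _ _ _ ⟨_, _, _⟩ ⟨_, _, _⟩
    rfl
  · intro t t' u h1 h2
    obtain ⟨t₁, t₂, t₃⟩ := h1
    generalize hu : CTree.node (bracket br t₁ t₂) (CTree.node t₁ t₃) = u at h2
    obtain ⟨u₁, u₂, u₃⟩ := h2
    simp only [CTree.node.injEq] at hu
    obtain ⟨e, rfl, rfl⟩ := hu
    have hinj : Function.Injective fun y => (labels t₁).foldr br y := by
      induction labels t₁ with
      | nil => exact Function.injective_id
      | cons x l ih => exact (h x).comp ih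
    rw [map_injective hinj e]

theorem isPartialInjection_of_mem {br : L → L → L} (h : ∀ x, Function.Injective (br x)) {f : Op L}
    (hf : f ∈ geometryMonoid br) : f.IsPartialInjection := by
  refine geometryMonoid_induction (p := IsPartialInjection)
    (fun α => isPartialInjection_assoc.shift α)
    (fun α => (isPartialInjection_semiComm h).shift α) ?_ ?_ ?_ hf
  · exact ⟨fun t u u' h1 h2 => h1.symm.trans h2, fun t t' u h1 h2 => h1.trans h2.symm⟩
  · rintro f g ⟨hf, hf'⟩ ⟨hg, hg'⟩
    constructor
    · rintro t u u' ⟨v, h1, h2⟩ ⟨v', h1', h2'⟩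
      rw [hf _ _ _ h1 h1'] at h2
      exact hg _ _ _ h2 h2'
    · rintro t t' u ⟨v, h1, h2⟩ ⟨v', h1', h2'⟩
      rw [hg' _ _ _ h2 h2'] at h1
      exact hf' _ _ _ h1 h1'
  · rintro f ⟨hf, hf'⟩
    exact ⟨fun t u u' h1 h2 => hf' _ _ _ h1 h2, fun t t' u h1 h2 => hf _ _ _ h1 h2⟩

/-! ### The action on evaluations -/

/-- `f` multiplies evaluations by constants. -/
def EvalBy (f : Op BBullet) (c d : BBullet) : Prop :=
  (∀ t u, f t u → spineEval u = spineEval t * c ∧ eval u = eval t * d) ∧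
    ∀ g, d * BBullet.shift g = BBullet.shift g * d

/-- The constant d sits before the shifted value of the right subtree; it can be moved to the end
because it commutes with the image of ∂. That is why the commutation is part of `EvalBy`. -/
theorem EvalBy.onLeft {f : Op BBullet} {c d : BBullet} (h : EvalBy f c d) :
    EvalBy (OnLeft f) d ((BBullet.a 0)⁻¹ * d * BBullet.a 0) := by
  constructor
  · rintro _ _ ⟨t₁, t₁', t₂, h1⟩
    obtain ⟨-, e⟩ := h.1 _ _ h1
    simp only [spineEval, eval, circ, e]
    constructor
    · rw [mul_assoc, mul_assoc, h.2]
    · rw [mul_assoc (eval t₁), h.2]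
      group
  · intro g
    have h1 : (BBullet.a 0)⁻¹ * BBullet.shift (BBullet.shift g) =
        BBullet.shift g * (BBullet.a 0)⁻¹ := by
      rw [inv_mul_eq_iff_eq_mul, ← mul_assoc, a_mul_shift, mul_inv_cancel_right]
    rw [mul_assoc, a_mul_shift, mul_assoc, ← mul_assoc d, h.2, ← mul_assoc, ← mul_assoc, h1]
    simp only [mul_assoc]

theorem EvalBy.onRight {f : Op BBullet} {c d : BBullet} (h : EvalBy f c d) :
    EvalBy (OnRight f) (BBullet.shift c) ((BBullet.a 0)⁻¹ * BBullet.shift d * BBullet.a 0) := by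
  constructor
  · rintro _ _ ⟨t₁, t₂, t₂', h1⟩
    obtain ⟨e, e'⟩ := h.1 _ _ h1
    simp only [spineEval, eval, circ, e, e', map_mul]
    constructor <;> group
  · intro g
    have h1 : (BBullet.a 0)⁻¹ * BBullet.shift (BBullet.shift g) =
        BBullet.shift g * (BBullet.a 0)⁻¹ := by
      rw [inv_mul_eq_iff_eq_mul, ← mul_assoc, a_mul_shift, mul_inv_cancel_right]
    rw [mul_assoc, a_mul_shift, mul_assoc, ← mul_assoc (BBullet.shift d), ← map_mul, h.2, map_mul,
      ← mul_assoc, ← mul_assoc, h1]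
    simp only [mul_assoc]

theorem EvalBy.exists_shift {f : Op BBullet} {c d : BBullet} (h : EvalBy f c d) (α : List Bool) :
    ∃ c d, EvalBy (shift α f) c d := by
  induction α with
  | nil => exact ⟨c, d, h⟩
  | cons x α ih =>
    obtain ⟨c', d', h'⟩ := ih
    cases x
    · exact ⟨_, _, h'.onLeft⟩
    · exact ⟨_, _, h'.onRight⟩

theorem EvalBy.exists_shift_replicate {f : Op BBullet} {c d : BBullet} (h : EvalBy f c d) (i : ℕ) :
    ∃ d, EvalBy (shift (List.replicate i true) f) (BBullet.shift^[i] c) d := by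
  induction i with
  | zero => exact ⟨d, h⟩
  | succ i ih =>
    obtain ⟨d', h'⟩ := ih
    rw [Function.iterate_succ_apply']
    exact ⟨_, h'.onRight⟩

theorem a_mul_a_mul_shift (g : BBullet) : BBullet.a 1 * BBullet.a 0 * BBullet.shift g =
    BBullet.shift (BBullet.shift (BBullet.shift g)) * (BBullet.a 1 * BBullet.a 0) := by
  have h : BBullet.a 1 * BBullet.shift (BBullet.shift g) =
      BBullet.shift (BBullet.shift (BBullet.shift g)) * BBullet.a 1 := by
    have := congrArg BBullet.shift (a_mul_shift g)
    rwa [map_mul, map_mul, shift_a] at this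
  rw [mul_assoc, a_mul_shift, ← mul_assoc, h, mul_assoc]

/-- The element `a 1 * a 0` also turns ∂ into ∂³, so its quotient with c commutes with the image of
∂. -/
theorem conj_mul_shift {c : BBullet} (h : ∀ g, c * BBullet.shift g =
      BBullet.shift (BBullet.shift (BBullet.shift g)) * c) (g : BBullet) :
    (BBullet.a 1 * BBullet.a 0)⁻¹ * c * BBullet.shift g =
      BBullet.shift g * ((BBullet.a 1 * BBullet.a 0)⁻¹ * c) := by
  have h1 : (BBullet.a 1 * BBullet.a 0)⁻¹ * BBullet.shift (BBullet.shift (BBullet.shift g)) =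
      BBullet.shift g * (BBullet.a 1 * BBullet.a 0)⁻¹ := by
    rw [inv_mul_eq_iff_eq_mul, ← mul_assoc, a_mul_a_mul_shift, mul_inv_cancel_right]
  rw [mul_assoc, h, ← mul_assoc, h1, mul_assoc]

theorem evalBy_assoc : EvalBy Assoc (BBullet.a 0)
    ((BBullet.a 1 * BBullet.a 0)⁻¹ * (BBullet.a 0 * BBullet.a 0)) := by
  constructor
  · rintro _ _ ⟨t₁, t₂, t₃⟩
    simp only [spineEval, eval, circ, map_mul, shift_a, zero_add]
    constructor
    · rw [mul_assoc _ (BBullet.a 0), a_mul_shift]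
      simp only [mul_assoc]
    · rw [mul_assoc _ (BBullet.a 0) (BBullet.shift (eval t₃)), a_mul_shift]
      group
  · refine conj_mul_shift fun g => ?_
    rw [mul_assoc, a_mul_shift, ← mul_assoc, a_mul_shift, mul_assoc]

theorem evalBy_semiComm : EvalBy (SemiComm BBullet.bracket) (BBullet.s 0)
    ((BBullet.a 1 * BBullet.a 0)⁻¹ * (BBullet.s 0 * (BBullet.a 1 * BBullet.a 0))) := by
  constructor
  · rintro _ _ ⟨t₁, t₂, t₃⟩
    simp only [spineEval, eval, eval_bracket, circ, map_mul, shift_a, zero_add]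
    rw [BBullet.bracket]
    constructor
    · have e := s_mul_shift (spineEval t₃)
      calc _ = eval t₁ * BBullet.shift (eval t₂) *
            (BBullet.s 0 * BBullet.shift (BBullet.shift (spineEval t₃))) := by group
        _ = _ := by
            rw [e]
            group
    · have e := s_mul_shift (eval t₃)
      calc eval t₁ * BBullet.shift (eval t₂) * BBullet.s 0 * (BBullet.shift (eval t₁))⁻¹ *
            (BBullet.shift (eval t₁) * BBullet.shift (BBullet.shift (eval t₃)) * BBullet.a 1) *
            BBullet.a 0 = eval t₁ * BBullet.shift (eval t₂) *
            (BBullet.s 0 * BBullet.shift (BBullet.shift (eval t₃))) * BBullet.a 1 * BBullet.a 0 := by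
            group
        _ = _ := by
            rw [e]
            group
  · refine conj_mul_shift fun g => ?_
    rw [mul_assoc, a_mul_a_mul_shift, ← mul_assoc, s_mul_shift, mul_assoc]

theorem exists_spineEval_eq {f : Op BBullet} (hf : f ∈ geometryMonoid BBullet.bracket) :
    ∃ c, ∀ t u, f t u → spineEval u = spineEval t * c := by
  refine geometryMonoid_induction (p := fun f => ∃ c, ∀ t u, f t u → spineEval u = spineEval t * c)
    (fun α => ?_) (fun α => ?_) ?_ ?_ ?_ hf
  · obtain ⟨c, d, h⟩ := evalBy_assoc.exists_shift α
    exact ⟨c, fun t u htu => (h.1 t u htu).1⟩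
  · obtain ⟨c, d, h⟩ := evalBy_semiComm.exists_shift α
    exact ⟨c, fun t u htu => (h.1 t u htu).1⟩
  · refine ⟨1, fun t u h => ?_⟩
    obtain rfl : t = u := h
    rw [mul_one]
  · rintro f g ⟨c, hc⟩ ⟨c', hc'⟩
    refine ⟨c * c', ?_⟩
    rintro t u ⟨v, h1, h2⟩
    rw [hc' _ _ h2, hc _ _ h1, mul_assoc]
  · rintro f ⟨c, hc⟩
    exact ⟨c⁻¹, fun t u h => by rw [hc _ _ h, mul_inv_cancel_right]⟩

theorem iterate_shift_a (i : ℕ) : BBullet.shift^[i] (BBullet.a 0) = BBullet.a i := by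
  induction i with
  | zero => rfl
  | succ i ih => rw [Function.iterate_succ_apply', ih, shift_a]

theorem spineEval_A {i : ℕ} {t u : CTree BBullet} (h : A (List.replicate i true) t u) :
    spineEval u = spineEval t * BBullet.a i := by
  obtain ⟨d, hd⟩ := evalBy_assoc.exists_shift_replicate i
  rw [← iterate_shift_a]
  exact (hd.1 t u h).1

theorem spineEval_S {i : ℕ} {t u : CTree BBullet}
    (h : S BBullet.bracket (List.replicate i true) t u) :
    spineEval u = spineEval t * BBullet.s i := by
  obtain ⟨d, hd⟩ := evalBy_semiComm.exists_shift_replicate i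
  rw [← iterate_shift_s]
  exact (hd.1 t u h).1

end Op

namespace Op

open CTree BBullet MulOpposite IsBraidSeq

variable {L : Type}

/-! ### Operators on shapes and labels -/

theorem shape_A {α : List Bool} {t u : CTree L} (h : A α t u) : A α (shape t) (shape u) := by
  induction α generalizing t u with
  | nil =>
    obtain ⟨t₁, t₂, t₃⟩ := h
    exact ⟨_, _, _⟩
  | cons c α ih =>
    cases c <;> obtain ⟨_, _, _, h⟩ := h <;> exact ⟨_, _, _, ih h⟩

theorem shape_S {br : L → L → L} {α : List Bool} {t u : CTree L} (h : S br α t u) :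
    S (fun _ y : Unit => y) α (shape t) (shape u) := by
  induction α generalizing t u with
  | nil =>
    obtain ⟨t₁, t₂, t₃⟩ := h
    have := SemiComm.mk (br := fun _ y : Unit => y) (shape t₁) (shape t₂) (shape t₃)
    rw [CTree.bracket, map_unit] at this
    change SemiComm _ _ _
    simpa only [shape, CTree.bracket, shape_map] using this
  | cons c α ih =>
    cases c <;> obtain ⟨_, _, _, h⟩ := h <;> exact ⟨_, _, _, ih h⟩

theorem A_fill {α : List Bool} {s s' : CTree Unit} (h : A α s s') :
    size s' = size s ∧ ∀ o (x : ℕ → L), A α (fill s o x) (fill s' o x) := by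
  induction α generalizing s s' with
  | nil =>
    obtain ⟨s₁, s₂, s₃⟩ := h
    refine ⟨by simp only [size, add_assoc], fun o x => ?_⟩
    have := Assoc.mk (fill s₁ o x) (fill s₂ (o + size s₁) x) (fill s₃ (o + size s₁ + size s₂) x)
    change Assoc _ _
    simpa only [fill, size, add_assoc] using this
  | cons c α ih =>
    cases c
    · obtain ⟨s₁, s₁', s₂, h⟩ := h
      obtain ⟨h1, h2⟩ := ih h
      refine ⟨by simp only [size, h1], fun o x => ?_⟩
      simp only [fill, h1]
      exact ⟨_, _, _, h2 o x⟩
    · obtain ⟨s₁, s₂, s₂', h⟩ := h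
      obtain ⟨h1, h2⟩ := ih h
      refine ⟨by simp only [size, h1], fun o x => ?_⟩
      exact ⟨_, _, _, h2 _ x⟩

/-- On label sequences, S is the crossing of the block of labels of the first subtree over that of
the second; labels outside these blocks stay fixed. -/
theorem S_fill {α : List Bool} {s s' : CTree Unit} (h : S (fun _ y : Unit => y) α s s') :
    size s' = size s ∧ ∀ o, ∃ o' p q, o ≤ o' ∧ o' + p + q < o + size s ∧
      ∀ x, S BBullet.bracket α (fill s o x) (fill s' o ((cross color o' p q).unop x)) := by
  induction α generalizing s s' with
  | nil =>
    obtain ⟨s₁, s₂, s₃⟩ := h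
    have hs₃ := size_pos s₃
    have e : bracket (fun _ y : Unit => y) s₁ s₂ = s₂ := map_unit _ _
    rw [e]
    refine ⟨by simp only [size]; omega, fun o => ⟨o, size s₁, size s₂, le_rfl,
      by simp only [size]; omega, fun x => ?_⟩⟩
    have := SemiComm.mk (br := BBullet.bracket) (fill s₁ o x) (fill s₂ (o + size s₁) x)
      (fill s₃ (o + size s₁ + size s₂) x)
    set x' := (cross color o (size s₁) (size s₂)).unop x with hx'
    have e1 : bracket BBullet.bracket (fill s₁ o x) (fill s₂ (o + size s₁) x) = fill s₂ o x' := by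
      refine map_fill fun j hj => ?_
      rw [foldr_labels_fill, hx', cross_color, if_neg (by omega), if_pos (by omega),
        add_right_comm]
    have e2 : fill s₁ o x = fill s₁ (o + size s₂) x' := by
      refine fill_congr fun j hj => ?_
      rw [hx', cross_color, if_neg (by omega), if_neg (by omega), if_pos (by omega)]
      congr 1
      omega
    have e3 : fill s₃ (o + size s₁ + size s₂) x = fill s₃ (o + size s₂ + size s₁) x' := by
      refine fill_congr fun j hj => ?_
      rw [hx', cross_color, if_neg (by omega), if_neg (by omega), if_neg (by omega)]
      congr 1
      omega
    rw [e1] at this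
    nth_rewrite 2 [e2] at this
    nth_rewrite 2 [e3] at this
    exact this
  | cons c α ih =>
    cases c
    · obtain ⟨s₁, s₁', s₂, h⟩ := h
      obtain ⟨h1, h2⟩ := ih h
      refine ⟨by simp only [size, h1], fun o => ?_⟩
      obtain ⟨o', p, q, ho, ho', h3⟩ := h2 o
      refine ⟨o', p, q, ho, by simp only [size]; omega, fun x => ?_⟩
      have e : fill s₂ (o + size s₁') ((cross color o' p q).unop x) = fill s₂ (o + size s₁) x := by
        rw [h1]
        refine fill_congr fun j hj => ?_
        rw [cross_color, if_neg (by omega), if_neg (by omega), if_neg (by omega)]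
      rw [fill, fill, e]
      exact ⟨_, _, _, h3 x⟩
    · obtain ⟨s₁, s₂, s₂', h⟩ := h
      obtain ⟨h1, h2⟩ := ih h
      refine ⟨by simp only [size, h1], fun o => ?_⟩
      obtain ⟨o', p, q, ho, ho', h3⟩ := h2 (o + size s₁)
      refine ⟨o', p, q, by omega, by simp only [size]; omega, fun x => ?_⟩
      have e : fill s₁ o ((cross color o' p q).unop x) = fill s₁ o x := by
        refine fill_congr fun j hj => ?_
        rw [cross_color, if_pos (by omega)]
      rw [fill, fill, e]
      exact ⟨_, _, _, h3 x⟩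

theorem labelSeq_eq_of_fill {u : CTree BBullet} {s : CTree Unit} {x : ℕ → BBullet}
    (hu : u = fill s 0 x) (hx : ∀ j, size s ≤ j → x j = 1) : labelSeq u = x := by
  subst hu
  funext j
  by_cases hj : j < size s
  · rw [labelSeq_fill hj, zero_add]
  · rw [labelSeq_of_size_le (by rw [size_fill]; omega), hx j (by omega)]

theorem linked_of_mem {f : Op BBullet} (hf : f ∈ geometryMonoid BBullet.bracket) :
    ∀ t u, f t u → size t = size u ∧ Linked (size t) (labelSeq t) (labelSeq u) := by
  refine geometryMonoid_induction
    (p := fun f => ∀ t u, f t u → size t = size u ∧ Linked (size t) (labelSeq t) (labelSeq u))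
    ?_ ?_ ?_ ?_ ?_ hf
  · intro α t u h
    obtain ⟨h1, h2⟩ := A_fill (L := BBullet) (shape_A h)
    have h3 := h2 0 (labelSeq t)
    rw [fill_labelSeq] at h3
    have h4 := (isPartialInjection_assoc.shift α).1 _ _ _ h h3
    have h5 : labelSeq u = labelSeq t := labelSeq_eq_of_fill h4 fun j hj =>
      labelSeq_of_size_le (by rwa [← size_shape, ← h1])
    rw [h5, ← size_shape t, ← size_shape u]
    exact ⟨h1.symm, .refl _⟩
  · intro α t u h
    obtain ⟨h1, h2⟩ := S_fill (shape_S h)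
    obtain ⟨o', p, q, -, h3, h4⟩ := h2 0
    rw [zero_add] at h3
    have h5 := h4 (labelSeq t)
    rw [fill_labelSeq] at h5
    have h6 := ((isPartialInjection_semiComm bracket_injective).shift α).1 _ _ _ h h5
    have h7 : labelSeq u = (cross color o' p q).unop (labelSeq t) :=
      labelSeq_eq_of_fill h6 fun j hj => by
        rw [cross_color, if_neg (by omega), if_neg (by omega), if_neg (by omega),
          labelSeq_of_size_le]
        rwa [← size_shape, ← h1]
    rw [h7, ← size_shape t, ← size_shape u]
    exact ⟨h1.symm, linked_cross h3.le _⟩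
  · intro t u h
    obtain rfl : t = u := h
    exact ⟨rfl, .refl _⟩
  · rintro f g hf hg t u ⟨v, h1, h2⟩
    obtain ⟨e, l⟩ := hf _ _ h1
    obtain ⟨e', l'⟩ := hg _ _ h2
    rw [← e] at l'
    exact ⟨e.trans e', .trans _ _ _ l l'⟩
  · intro f hf t u h
    obtain ⟨e, l⟩ := hf _ _ h
    rw [← e]
    exact ⟨rfl, .symm _ _ l⟩

/-- The value of an operator of the geometry monoid is determined by its argument and by the
evaluation. -/
theorem eq_of_spineEval_eq {f g : Op BBullet} (hf : f ∈ geometryMonoid BBullet.bracket)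
    (hg : g ∈ geometryMonoid BBullet.bracket) {t u v : CTree BBullet} (hu : f t u) (hv : g t v)
    (h : spineEval u = spineEval v) : u = v := by
  obtain ⟨e, l⟩ := linked_of_mem (mul_mem (inverse_mem hf) hg) u v ⟨t, hu, hv⟩
  exact eq_of_linked e l h

/-! ### Domains -/

/-- `f` is defined on all sufficiently deep shapes, for the labels that are sufficiently divisible by
full twists. -/
def WidelyDefined (f : Op BBullet) : Prop :=
  ∃ D, ∀ e s, D + e ≤ minDepth s → ∃ s', e ≤ minDepth s' ∧ size s' = size s ∧
    ∀ c : (Function.End (ℕ → BBullet))ᵐᵒᵖ,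
      (∀ r ∈ Submonoid.closure (color '' {j | j < size s - 1}), Commute c r ∧ ∃ m,
        (∃ q ∈ Submonoid.closure (color '' {j | j < size s - 1}), c ^ m = r * q) ∧
        (∃ q ∈ Submonoid.closure (color '' {j | j < size s - 1}), c ^ m = q * r)) →
      ∃ m, ∀ k z, ∃ z', f (fill s 0 ((c ^ (m + k)).unop z)) (fill s' 0 ((c ^ k).unop z'))

theorem shift_deep {f : Op Unit} (α : List Bool)
    (h : ∀ e s, 2 + e ≤ minDepth s → ∃ s', e ≤ minDepth s' ∧ f s s') :
    ∀ e s, α.length + 2 + e ≤ minDepth s → ∃ s', e ≤ minDepth s' ∧ shift α f s s' := by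
  induction α with
  | nil => simpa [shift] using h
  | cons c α ih =>
    intro e s hs
    rw [List.length_cons] at hs
    cases s with
    | leaf x => simp only [minDepth] at hs; omega
    | node s₁ s₂ =>
      simp only [minDepth] at hs
      cases c
      · obtain ⟨s', h1, h2⟩ := ih e s₁ (by omega)
        exact ⟨.node s' s₂, by simp only [minDepth]; omega, _, _, _, h2⟩
      · obtain ⟨s', h1, h2⟩ := ih e s₂ (by omega)
        exact ⟨.node s₁ s', by simp only [minDepth]; omega, _, _, _, h2⟩

theorem assoc_deep (e : ℕ) (s : CTree Unit) (h : 2 + e ≤ minDepth s) :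
    ∃ s', e ≤ minDepth s' ∧ Assoc s s' := by
  match s, h with
  | .node s₁ (.node s₂ s₃), h =>
    refine ⟨_, ?_, ⟨s₁, s₂, s₃⟩⟩
    simp only [minDepth] at h ⊢
    omega
  | .node _ (.leaf _), h => simp only [minDepth] at h; omega
  | .leaf _, h => simp only [minDepth] at h; omega

theorem assoc_inverse_deep (e : ℕ) (s : CTree Unit) (h : 2 + e ≤ minDepth s) :
    ∃ s', e ≤ minDepth s' ∧ inverse Assoc s s' := by
  match s, h with
  | .node (.node s₁ s₂) s₃, h =>
    refine ⟨.node s₁ (.node s₂ s₃), ?_, ⟨s₁, s₂, s₃⟩⟩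
    simp only [minDepth] at h ⊢
    omega
  | .node (.leaf _) _, h => simp only [minDepth] at h; omega
  | .leaf _, h => simp only [minDepth] at h; omega

theorem semiComm_unit (s₁ s₂ s₃ : CTree Unit) : SemiComm (fun _ y : Unit => y)
    (.node s₁ (.node s₂ s₃)) (.node s₂ (.node s₁ s₃)) := by
  have := SemiComm.mk (br := fun _ y : Unit => y) s₁ s₂ s₃
  rwa [CTree.bracket, map_unit] at this

theorem semiComm_deep (e : ℕ) (s : CTree Unit) (h : 2 + e ≤ minDepth s) :
    ∃ s', e ≤ minDepth s' ∧ SemiComm (fun _ y : Unit => y) s s' := by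
  match s, h with
  | .node s₁ (.node s₂ s₃), h =>
    refine ⟨_, ?_, semiComm_unit s₁ s₂ s₃⟩
    simp only [minDepth] at h ⊢
    omega
  | .node _ (.leaf _), h => simp only [minDepth] at h; omega
  | .leaf _, h => simp only [minDepth] at h; omega

theorem semiComm_inverse_deep (e : ℕ) (s : CTree Unit) (h : 2 + e ≤ minDepth s) :
    ∃ s', e ≤ minDepth s' ∧ inverse (SemiComm fun _ y : Unit => y) s s' := by
  match s, h with
  | .node s₁ (.node s₂ s₃), h =>
    refine ⟨_, ?_, semiComm_unit s₂ s₁ s₃⟩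
    simp only [minDepth] at h ⊢
    omega
  | .node _ (.leaf _), h => simp only [minDepth] at h; omega
  | .leaf _, h => simp only [minDepth] at h; omega

theorem widelyDefined_A (α : List Bool) : WidelyDefined (A α) := by
  refine ⟨α.length + 2, fun e s hs => ?_⟩
  obtain ⟨s', h1, h2⟩ := shift_deep α assoc_deep e s hs
  obtain ⟨h3, h4⟩ := A_fill (L := BBullet) h2
  refine ⟨s', h1, h3, fun c _ => ⟨0, fun k z => ⟨z, ?_⟩⟩⟩
  rw [zero_add]
  exact h4 0 _

theorem widelyDefined_A_inverse (α : List Bool) : WidelyDefined (A α).inverse := by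
  refine ⟨α.length + 2, fun e s hs => ?_⟩
  obtain ⟨s', h1, h2⟩ := shift_deep α assoc_inverse_deep e s hs
  replace h2 := (congrFun₂ (inverse_shift α (Assoc : Op Unit)) s s').mpr h2
  obtain ⟨h3, h4⟩ := A_fill (L := BBullet) h2
  refine ⟨s', h1, h3.symm, fun c _ => ⟨0, fun k z => ⟨z, ?_⟩⟩⟩
  rw [zero_add]
  exact h4 0 _

theorem cross_mem_closure_lt {N o p q : ℕ} (h : o + p + q < N) :
    cross color o p q ∈ Submonoid.closure (color '' {j | j < N - 1}) :=
  Submonoid.closure_mono (Set.image_mono fun j hj => by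
    have := hj.2
    simp only [Set.mem_ofPred_eq]
    omega) (cross_mem o p q)

theorem widelyDefined_S (α : List Bool) : WidelyDefined (S BBullet.bracket α) := by
  refine ⟨α.length + 2, fun e s hs => ?_⟩
  obtain ⟨s', h1, h2⟩ := shift_deep α semiComm_deep e s hs
  obtain ⟨h3, h4⟩ := S_fill h2
  obtain ⟨o, p, q, -, h5, h6⟩ := h4 0
  rw [zero_add] at h5
  refine ⟨s', h1, h3, fun c hc => ⟨0, fun k z => ⟨(cross color o p q).unop z, ?_⟩⟩⟩
  have h7 := (hc _ (cross_mem_closure_lt h5)).1.pow_left k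
  rw [zero_add]
  have h8 := h6 ((c ^ k).unop z)
  have h9 : (cross color o p q).unop ((c ^ k).unop z) = (c ^ k).unop ((cross color o p q).unop z) :=
    congrArg (fun r => r.unop z) h7.eq
  rwa [h9] at h8

/-- The inverse is applicable when the labels lie in the image of a block crossing. A power of c
factors with that crossing acting last, so its image qualifies. -/
theorem widelyDefined_S_inverse (α : List Bool) : WidelyDefined (S BBullet.bracket α).inverse := by
  refine ⟨α.length + 2, fun e s hs => ?_⟩
  obtain ⟨s', h1, h2⟩ := shift_deep α semiComm_inverse_deep e s hs
  replace h2 := (congrFun₂ (inverse_shift α (SemiComm fun _ y : Unit => y : Op Unit)) s s').mpr h2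
  obtain ⟨h3, h4⟩ := S_fill h2
  obtain ⟨o, p, q, -, h5, h6⟩ := h4 0
  rw [zero_add, ← h3] at h5
  refine ⟨s', h1, h3.symm, fun c hc => ?_⟩
  obtain ⟨-, m, -, d, hd, h7⟩ := hc _ (cross_mem_closure_lt h5)
  refine ⟨m, fun k z => ⟨d.unop z, ?_⟩⟩
  have h8 : c ^ (m + k) = d * c ^ k * cross color o p q := by
    rw [add_comm, pow_add, h7, ← mul_assoc, ((hc d hd).1.pow_left k).eq]
  have h9 := h6 ((c ^ k).unop (d.unop z))
  rw [h8]
  exact h9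

/-- The spare depth e and the spare power k in the definition are there for this composition: the
first operator must leave enough of both for the second. -/
theorem WidelyDefined.mul {f g : Op BBullet} (hf : WidelyDefined f) (hg : WidelyDefined g) :
    WidelyDefined (f * g) := by
  obtain ⟨D, hf⟩ := hf
  obtain ⟨D', hg⟩ := hg
  refine ⟨D + D', fun e s hs => ?_⟩
  obtain ⟨s', h1, h2, h3⟩ := hf (D' + e) s (by omega)
  obtain ⟨s'', h1', h2', h3'⟩ := hg e s' h1
  refine ⟨s'', h1', h2'.trans h2, fun c hc => ?_⟩
  rw [h2] at h3'
  obtain ⟨m, hm⟩ := h3 c hc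
  obtain ⟨m', hm'⟩ := h3' c hc
  refine ⟨m + m', fun k z => ?_⟩
  obtain ⟨z', hz'⟩ := hm (m' + k) z
  obtain ⟨z'', hz''⟩ := hm' k z'
  rw [add_assoc]
  exact ⟨z'', _, hz', hz''⟩

theorem widelyDefined_of_mem {f : Op BBullet} (hf : f ∈ geometryMonoid BBullet.bracket) :
    WidelyDefined f := by
  induction hf using Submonoid.closure_induction with
  | mem f hf =>
    obtain ⟨α, rfl | rfl | rfl | rfl⟩ := hf
    · exact widelyDefined_A α
    · exact widelyDefined_A_inverse α
    · exact widelyDefined_S α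
    · exact widelyDefined_S_inverse α
  | one => exact ⟨0, fun e s hs => ⟨s, by omega, rfl, fun c _ => ⟨0, fun k z => ⟨z, by
      rw [zero_add]
      rfl⟩⟩⟩⟩
  | mul f g _ _ hf hg => exact hf.mul hg

theorem exists_of_mem {f : Op BBullet} (hf : f ∈ geometryMonoid BBullet.bracket) :
    ∃ t u, f t u := by
  obtain ⟨D, h⟩ := widelyDefined_of_mem hf
  obtain ⟨s', -, -, h1⟩ := h 0 (full D) (minDepth_full D).ge
  obtain ⟨c, -, hc⟩ := isBraidSeq_color.exists_pow_twist (size (full D) - 1)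
  obtain ⟨m, hm⟩ := h1 c hc
  -- Any label sequence would do; the constant sequence 1 is chosen.
  obtain ⟨z', hz⟩ := hm 0 1
  exact ⟨_, _, hz⟩

/-- The element of `B_•` by which an operator multiplies the evaluation. -/
noncomputable def evalFactor (f : geometryMonoid BBullet.bracket) : BBullet :=
  (exists_spineEval_eq f.2).choose

theorem spineEval_eq {f : geometryMonoid BBullet.bracket} {t u : CTree BBullet}
    (h : (f : Op BBullet) t u) : spineEval u = spineEval t * evalFactor f :=
  (exists_spineEval_eq f.2).choose_spec t u h

theorem evalFactor_eq {f : geometryMonoid BBullet.bracket} {c : BBullet}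
    (h : ∀ t u, (f : Op BBullet) t u → spineEval u = spineEval t * c) : evalFactor f = c := by
  obtain ⟨t, u, htu⟩ := exists_of_mem f.2
  exact mul_left_cancel ((spineEval_eq htu).symm.trans (h t u htu))

/-- The homomorphism from the geometry monoid to `B_•`. -/
noncomputable def evalHom : geometryMonoid BBullet.bracket →* BBullet where
  toFun := evalFactor
  map_one' := evalFactor_eq fun t u h => by
    obtain rfl : t = u := h
    rw [mul_one]
  map_mul' f g := evalFactor_eq fun t u h => by
    obtain ⟨v, h1, h2⟩ := h
    rw [spineEval_eq h2, spineEval_eq h1, mul_assoc]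

theorem evalHom_A (i : ℕ) :
    evalHom ⟨A (List.replicate i true), A_mem _ _⟩ = BBullet.a i :=
  evalFactor_eq fun _ _ h => spineEval_A h

theorem evalHom_S (i : ℕ) :
    evalHom ⟨S BBullet.bracket (List.replicate i true), S_mem _ _⟩ = BBullet.s i :=
  evalFactor_eq fun _ _ h => spineEval_S h

theorem evalHom_surjective : Function.Surjective evalHom := by
  intro g
  induction g using BBullet.induction with
  | one => exact ⟨1, map_one _⟩
  | ha i => exact ⟨_, evalHom_A i⟩
  | hs i => exact ⟨_, evalHom_S i⟩
  | inv x h =>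
    obtain ⟨f, rfl⟩ := h
    exact ⟨⟨(f : Op BBullet).inverse, inverse_mem f.2⟩, evalFactor_eq fun t u h => by
      rw [spineEval_eq (f := f) h]
      exact (mul_inv_cancel_right _ _).symm⟩
  | mul x y hx hy =>
    obtain ⟨f, rfl⟩ := hx
    obtain ⟨g, rfl⟩ := hy
    exact ⟨f * g, map_mul _ _ _⟩

/-- One direction cancels `spineEval` at a common argument. The other uses rigidity of linked trees
for the agreement of values. -/
theorem nearEq_iff (f g : geometryMonoid BBullet.bracket) :
    NearEq (f : Op BBullet) (g : Op BBullet) ↔ evalHom f = evalHom g := by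
  constructor
  · rintro ⟨⟨t, ⟨u, hu⟩, ⟨v, hv⟩⟩, h⟩
    have e := spineEval_eq hu
    rw [h t u v hu hv, spineEval_eq hv] at e
    exact (mul_left_cancel e).symm
  · intro h
    refine ⟨?_, fun t u v hu hv => eq_of_spineEval_eq f.2 g.2 hu hv ?_⟩
    -- A pair in the nonempty operator f⁻¹g passes through a tree on which both f and g are defined.
    · obtain ⟨u, v, t, h1, h2⟩ := exists_of_mem (mul_mem (inverse_mem f.2) g.2)
      exact ⟨t, ⟨u, h1⟩, ⟨v, h2⟩⟩
    · rw [spineEval_eq hu, spineEval_eq hv]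
      exact congrArg _ h

/-- Near-equality already is the kernel of a homomorphism, so generating a congruence from it adds
nothing. -/
theorem nearEqCon_eq_ker : nearEqCon BBullet.bracket = Con.ker evalHom := by
  apply le_antisymm
  · rw [nearEqCon, Con.conGen_le]
    intro f g h
    exact (nearEq_iff f g).mp h
  · intro f g h
    exact ConGen.Rel.of _ _ ((nearEq_iff f g).mpr h)

end Op

theorem proposition5p10 :
    IsLeftCancellativeLD BBullet.bracket ∧
    (∀ f ∈ Op.geometryMonoid BBullet.bracket, f.IsPartialInjection) ∧
    (∀ f g : Op.geometryMonoid BBullet.bracket,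
      Op.nearEqCon BBullet.bracket f g ↔ Op.NearEq (f : Op BBullet) (g : Op BBullet)) ∧
    ∃ e : BBullet ≃* Op.GeometryGroup BBullet.bracket,
      (∀ i : ℕ, e (BBullet.a i) = Op.clsA BBullet.bracket (List.replicate i true)) ∧
      (∀ i : ℕ, e (BBullet.s i) = Op.clsS BBullet.bracket (List.replicate i true)) := by
  refine ⟨BBullet.isLeftCancellativeLD,
    fun f hf => Op.isPartialInjection_of_mem BBullet.bracket_injective hf, fun f g => ?_, ?_⟩
  · rw [Op.nearEqCon_eq_ker, Op.nearEq_iff]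
    exact Con.ker_rel (f := Op.evalHom)
  · refine ⟨((Con.congr (.refl _) Op.nearEqCon_eq_ker).trans
      (Con.quotientKerEquivOfSurjective Op.evalHom Op.evalHom_surjective)).symm, ?_, ?_⟩
    · intro i
      rw [MulEquiv.symm_apply_eq]
      exact (Op.evalHom_A i).symm
    · intro i
      rw [MulEquiv.symm_apply_eq]
      exact (Op.evalHom_S i).symm
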